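/- Notation. $\mathbb X,\mathbb Y$ are Euclidean spaces (finite-dimensional real inner product spaces), and $t_k\searrow 0$ means $t_k>0$, $t_k\to 0$. For a closed set $Q$ in a Euclidean space and $x\in Q$, let $$\mathcal T_Q(x)=\{d\mid \exists\, d_k\to d,\ t_k\searrow 0:\ x+t_kd_k\in Q\ \forall k\},\qquad \widehat{\mathcal N}_Q(x)=\{\eta\mid \langle\eta,x'-x\rangle\le o(\|x'-x\|)\ \forall x'\in Q\},$$ $$\mathcal N_Q(x)=\{\eta\mid \exists\, x_k\to x,\ \eta_k\to\eta:\ \eta_k\in\widehat{\mathcal N}_Q(x_k)\ \forall k\},\qquad \mathcal N_Q(x;d)=\{\eta\mid\exists\, d_k\to d,\ t_k\searrow0,\ \eta_k\to\eta:\ \eta_k\in\widehat{\mathcal N}_Q(x+t_kd_k)\ \forall k\};$$ for $x\notin Q$ the sets $\mathcal T_Q(x),\widehat{\mathcal N}_Q(x),\mathcal N_Q(x)$ are empty. For a set-valued mapping $\Psi$ with closed graph and $(x,y)\in\operatorname{gph}\Psi$, the graphical derivative $D\Psi(x,y)$ is the mapping with graph $\mathcal T_{\operatorname{gph}\Psi}(x,y)$.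 The graphical subderivative $D_{\rm sub}\Psi(x,y)$ assigns to a unit vector $u$ all unit vectors $v$ for which there are $u_k\to u$, $v_k\to v$, $t_k\searrow0$, $\tau_k\searrow0$ with $\tau_k/t_k\to\infty$ and $(x+t_ku_k,y+\tau_kv_k)\in\operatorname{gph}\Psi$ for all $k$. A subset of $\mathbb R^m$ is polyhedral if it is a finite union of convex polyhedral sets; $D\subset\mathbb R^m$ is locally polyhedral around $x\in D$ if $D\cap\{z\mid |z_i-x_i|\le\varepsilon,\ i=1,\dots,m\}$ is polyhedral for some $\varepsilon>0$. For $\Phi\colon\mathbb X\rightrightarrows\mathbb Y$ with closed graph, $(\bar x,0)\in\operatorname{gph}\Phi$, $u\in\mathbb X$ with $\|u\|=1$, and $v,y^*\in\mathbb Y$, Gfrerer's pseudo-coderivative of order 2, $\widetilde D^*_2\Phi((\bar x,0);(u,v))(y^*)$, is the set of all $x^*\in\mathbb X$ for which there are $u_k\to u$, $v_k\to v$, $t_k\searrow0$, $x_k^*\to x^*$, $y_k^*\to y^*$ with $$\Bigl(x_k^*,-\frac{y_k^*}{t_k\|u_k\|}\Bigr)\in\widehat{\mathcal N}_{\operatorname{gph}\Phi}(\bar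 x+t_ku_k,\;t_kv_k)\quad\forall k;$$ the pseudo-coderivative of order 2, $D^*_2\Phi((\bar x,0);(u,v))(y^*)$, is defined in the same way with $(t_k\|u_k\|)^2v_k$ in place of $t_kv_k$. Theorem. Let $g\colon\mathbb X\to\mathbb Y$ be twice continuously differentiable, let $D\subset\mathbb Y$ be closed, and let $\Phi(x)=g(x)-D$. Let $(\bar x,0)\in\operatorname{gph}\Phi$, $u\in\mathbb X$ with $\|u\|=1$, and $x^*\in\widetilde D^*_2\Phi((\bar x,0);(u,v))(y^*)$ for some $v,y^*\in\mathbb Y$. Consider the relations $$(1)\quad x^*=\nabla^2\langle y^*,g\rangle(\bar x)(u)+\nabla g(\bar x)^*z^*,\qquad(2)\quad y^*\in\mathcal N_D(g(\bar x);\nabla g(\bar x)u-v)\cap\ker\nabla g(\bar x)^*.$$ (i) There is $z^*\in\mathbb Y$ with $\langle y^*,z^*\rangle=0$ satisfying (1), and (2) holds. (ii) If $D\mathcal N_D(g(\bar x),y^*)(0)\cap\ker\nabla g(\bar x)^*=\{0\}$, or if $\nabla g(\bar x)u\ne v$ and $$D_{\rm sub}\mathcal N_D(g(\bar x),y^*)\Bigl(\tfrac{\nabla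 g(\bar x)u-v}{\|\nabla g(\bar x)u-v\|}\Bigr)\cap\ker\nabla g(\bar x)^*=\varnothing,$$ then there is $z^*\in D\mathcal N_D(g(\bar x),y^*)(\nabla g(\bar x)u-v)$ such that (1) and (2) hold. (iii) If $\mathbb Y=\mathbb R^m$ and $D$ is locally polyhedral around $g(\bar x)$, then $\mathcal N_D(g(\bar x);\nabla g(\bar x)u-v)=\mathcal N_{\mathcal T_D(g(\bar x))}(\nabla g(\bar x)u-v)$, and there is $z^*\in\mathcal T_{\mathcal N_{\mathcal T_D(g(\bar x))}(\nabla g(\bar x)u-v)}(y^*)$ such that (1) and (2) hold. (iv) Let $\mathbb Y=\mathbb R^m$, let $D$ be locally polyhedral around $g(\bar x)$, and let (now without assuming $x^*\in\widetilde D^*_2\Phi((\bar x,0);(u,v))(y^*)$) $x^*\in D^*_2\Phi((\bar x,0);(u,v))(y^*)$ for some $v,y^*\in\mathbb R^m$. Put $\mathbf T(u)=\mathcal T_{\mathcal T_D(g(\bar x))}(\nabla g(\bar x)u)$ and $w_s(u,v)=\nabla g(\bar x)s+\tfrac12\nabla^2g(\bar x)[u,u]-v$ for $s\in\mathbb X$.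 Then there are $s\in\mathbb X$ and $z^*\in\mathcal T_{\mathcal N_{\mathbf T(u)}(w_s(u,v))}(y^*)$ such that (1) holds and $y^*\in\mathcal N_{\mathbf T(u)}(w_s(u,v))\cap\ker\nabla g(\bar x)^*$. -/

import Mathlib

open Filter Topology

noncomputable section

namespace VarAnalysis

section Cones

variable {E : Type*} [NormedAddCommGroup E] [InnerProductSpace ℝ E]

/-- The (Bouligand) tangent cone `T_Q(x)` (empty if `x ∉ Q`). -/
def tangentCone (Q : Set E) (x : E) : Set E :=
  {d | x ∈ Q ∧ ∃ (dk : ℕ → E) (t : ℕ → ℝ), Tendsto dk atTop (𝓝 d) ∧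
    (∀ k, 0 < t k) ∧ Tendsto t atTop (𝓝 0) ∧ ∀ k, x + t k • dk k ∈ Q}

/-- On points of `Q`, `tangentCone` is Mathlib's `posTangentConeAt`. -/
theorem tangentCone_eq_posTangentConeAt {Q : Set E} {x : E} (hx : x ∈ Q) :
    tangentCone Q x = posTangentConeAt Q x := by
  ext y
  constructor
  · rintro ⟨-, dk, t, hd, ht, ht0, hQ⟩
    refine mem_tangentConeAt_of_seq atTop (fun k => (t k)⁻¹.toNNReal)
      (fun k => t k • dk k) (by simpa using ht0.smul hd) (Eventually.of_forall hQ) ?_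
    refine hd.congr fun k => ?_
    rw [NNReal.smul_def, Real.coe_toNNReal _ (inv_pos.2 (ht k)).le, smul_smul,
      inv_mul_cancel₀ (ht k).ne', one_smul]
  · intro h
    refine ⟨hx, ?_⟩
    by_cases hy : y = 0
    · subst hy
      refine ⟨fun _ => 0, fun k => 1 / ((k : ℝ) + 1), tendsto_const_nhds, fun k => by positivity,
        tendsto_one_div_add_atTop_nhds_zero_nat, fun k => by simpa using hx⟩
    · obtain ⟨α, l, hl, c, d, hd, hQ, hcd⟩ := exists_fun_of_mem_tangentConeAt h
      have key : ∀ k : ℕ, ∃ a, ‖y‖ / 2 < ‖c a • d a‖ ∧ ‖d a‖ < ‖y‖ / 2 * (1 / ((k : ℝ) + 1)) ∧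
          x + d a ∈ Q ∧ dist (c a • d a) y < 1 / ((k : ℝ) + 1) := by
        intro k
        have hp : 0 < ‖y‖ := norm_pos_iff.2 hy
        have e1 := hcd.norm.eventually (lt_mem_nhds (show ‖y‖ / 2 < ‖y‖ by linarith))
        have e2 := (tendsto_zero_iff_norm_tendsto_zero.1 hd).eventually
          (gt_mem_nhds (show (0 : ℝ) < ‖y‖ / 2 * (1 / ((k : ℝ) + 1)) by positivity))
        have e3 := Metric.tendsto_nhds.1 hcd (1 / ((k : ℝ) + 1)) (by positivity)
        exact (e1.and (e2.and (hQ.and e3))).exists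
      choose a h1 h2 h3 h4 using key
      have hp : 0 < ‖y‖ := norm_pos_iff.2 hy
      have hc : ∀ k, 0 < (c (a k) : ℝ) := by
        intro k
        refine lt_of_le_of_ne (c (a k)).2 fun h0 => ?_
        have := h1 k
        rw [NNReal.smul_def, ← h0] at this
        simp at this
        linarith
      refine ⟨fun k => c (a k) • d (a k), fun k => (c (a k) : ℝ)⁻¹, ?_,
        fun k => inv_pos.2 (hc k), ?_, fun k => ?_⟩
      · rw [tendsto_iff_dist_tendsto_zero]
        exact squeeze_zero (fun _ => dist_nonneg) (fun k => (h4 k).le)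
          tendsto_one_div_add_atTop_nhds_zero_nat
      · refine squeeze_zero (fun k => (inv_pos.2 (hc k)).le) (fun k => ?_)
          tendsto_one_div_add_atTop_nhds_zero_nat
        have h5 := h1 k
        rw [NNReal.smul_def, norm_smul, Real.norm_of_nonneg (hc k).le] at h5
        have h6 := mul_lt_mul_of_pos_left (h2 k) (hc k)
        rw [inv_le_comm₀ (hc k) (by positivity)]
        have h8 : (1 : ℝ) < c (a k) * (1 / ((k : ℝ) + 1)) := by
          by_contra hcon
          push Not at hcon
          nlinarith
        rw [mul_one_div, lt_div_iff₀ (by positivity)] at h8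
        rw [one_div, inv_inv]
        linarith
      · beta_reduce
        rw [NNReal.smul_def, smul_smul, inv_mul_cancel₀ (hc k).ne', one_smul]
        exact h3 k

/-- The regular (Fréchet) normal cone `N̂_Q(x)` (empty if `x ∉ Q`):
`⟪η, x' - x⟫ ≤ o(‖x' - x‖)` for `x' ∈ Q`. -/
def regNormalCone (Q : Set E) (x : E) : Set E :=
  {η | x ∈ Q ∧ ∀ ε : ℝ, 0 < ε → ∀ᶠ x' in 𝓝[Q] x, inner ℝ η (x' - x) ≤ ε * ‖x' - x‖}

/-- The limiting (Mordukhovich) normal cone `N_Q(x)` (empty if `x ∉ Q`). -/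
def limNormalCone (Q : Set E) (x : E) : Set E :=
  {η | x ∈ Q ∧ ∃ (xk ηk : ℕ → E), Tendsto xk atTop (𝓝 x) ∧ Tendsto ηk atTop (𝓝 η) ∧
    ∀ k, ηk k ∈ regNormalCone Q (xk k)}

/-- The directional limiting normal cone `N_Q(x; d)`. -/
def dirNormalCone (Q : Set E) (x d : E) : Set E :=
  {η | ∃ (dk : ℕ → E) (t : ℕ → ℝ) (ηk : ℕ → E), Tendsto dk atTop (𝓝 d) ∧
    (∀ k, 0 < t k) ∧ Tendsto t atTop (𝓝 0) ∧ Tendsto ηk atTop (𝓝 η) ∧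
    ∀ k, ηk k ∈ regNormalCone Q (x + t k • dk k)}

/-- Convex polyhedral sets: finite intersections of closed half-spaces. -/
def IsConvexPolyhedral (P : Set E) : Prop :=
  ∃ H : Finset (E × ℝ), P = {z | ∀ h ∈ H, inner ℝ h.1 z ≤ h.2}

/-- Polyhedral sets: finite unions of convex polyhedral sets. -/
def IsPolyhedral (Q : Set E) : Prop :=
  ∃ S : Set (Set E), S.Finite ∧ (∀ P ∈ S, IsConvexPolyhedral P) ∧ Q = ⋃₀ S

end Cones

/-- `Q ⊆ ℝᵐ` is locally polyhedral around `x`: its intersection with some box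
`{z | |zᵢ - xᵢ| ≤ ε for all i}`, `ε > 0`, is polyhedral. -/
def IsLocallyPolyhedral {m : ℕ} (Q : Set (EuclideanSpace ℝ (Fin m)))
    (x : EuclideanSpace ℝ (Fin m)) : Prop :=
  ∃ ε : ℝ, 0 < ε ∧ IsPolyhedral (Q ∩ {z | ∀ i, |z i - x i| ≤ ε})

section Maps

variable {X Y : Type*} [NormedAddCommGroup X] [InnerProductSpace ℝ X]
  [NormedAddCommGroup Y] [InnerProductSpace ℝ Y]

/-- The graph of a set-valued mapping `Φ : X ⇉ Y`, as a subset of the Euclidean product space. -/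
def gph (Φ : X → Set Y) : Set (WithLp 2 (X × Y)) :=
  {p | p.snd ∈ Φ p.fst}

/-- The graphical derivative `DΦ(x, y) : X ⇉ Y`. -/
def graphicalDeriv (Φ : X → Set Y) (x : X) (y : Y) (u : X) : Set Y :=
  {v | WithLp.toLp 2 (u, v) ∈ tangentCone (gph Φ) (WithLp.toLp 2 (x, y))}

/-- The graphical subderivative `D_sub Φ(x, y) : 𝕊_X ⇉ 𝕊_Y`;
it is used only for `u` in the unit sphere. -/
def graphicalSubderiv (Φ : X → Set Y) (x : X) (y : Y) (u : X) : Set Y :=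
  {v | ‖v‖ = 1 ∧ ∃ (uk : ℕ → X) (vk : ℕ → Y) (t τ : ℕ → ℝ),
    Tendsto uk atTop (𝓝 u) ∧ Tendsto vk atTop (𝓝 v) ∧
    (∀ k, 0 < t k) ∧ Tendsto t atTop (𝓝 0) ∧ (∀ k, 0 < τ k) ∧ Tendsto τ atTop (𝓝 0) ∧
    Tendsto (fun k => τ k / t k) atTop atTop ∧
    ∀ k, WithLp.toLp 2 (x + t k • uk k, y + τ k • vk k) ∈ gph Φ}

/-- The pseudo-coderivative of order `γ` of `Φ` at `(x, y)` in direction `(u, v)`, `‖u‖ = 1`. -/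
def pseudoCoderiv (γ : ℝ) (Φ : X → Set Y) (x : X) (y : Y) (u : X) (v : Y) (ys : Y) : Set X :=
  {xs | ∃ (uk xsk : ℕ → X) (vk ysk : ℕ → Y) (t : ℕ → ℝ),
    Tendsto uk atTop (𝓝 u) ∧ Tendsto vk atTop (𝓝 v) ∧
    (∀ k, 0 < t k) ∧ Tendsto t atTop (𝓝 0) ∧
    Tendsto xsk atTop (𝓝 xs) ∧ Tendsto ysk atTop (𝓝 ys) ∧
    ∀ k, WithLp.toLp 2 (xsk k, -(((t k * ‖uk k‖) ^ (γ - 1))⁻¹ • ysk k)) ∈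
      regNormalCone (gph Φ)
        (WithLp.toLp 2 (x + t k • uk k, y + (t k * ‖uk k‖) ^ γ • vk k))}

/-- Gfrerer's pseudo-coderivative of order `γ` of `Φ` at `(x, y)` in direction `(u, v)`,
`‖u‖ = 1`. -/
def gfrererPseudoCoderiv (γ : ℝ) (Φ : X → Set Y) (x : X) (y : Y) (u : X) (v : Y) (ys : Y) :
    Set X :=
  {xs | ∃ (uk xsk : ℕ → X) (vk ysk : ℕ → Y) (t : ℕ → ℝ),
    Tendsto uk atTop (𝓝 u) ∧ Tendsto vk atTop (𝓝 v) ∧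
    (∀ k, 0 < t k) ∧ Tendsto t atTop (𝓝 0) ∧
    Tendsto xsk atTop (𝓝 xs) ∧ Tendsto ysk atTop (𝓝 ys) ∧
    ∀ k, WithLp.toLp 2 (xsk k, -(((t k * ‖uk k‖) ^ (γ - 1))⁻¹ • ysk k)) ∈
      regNormalCone (gph Φ) (WithLp.toLp 2 (x + t k • uk k, y + t k • vk k))}

/-- The constraint mapping `Φ(x) = g(x) - D`. -/
def constraintMap (g : X → Y) (D : Set Y) (x : X) : Set Y :=
  {y | ∃ d ∈ D, y = g x - d}

variable [FiniteDimensional ℝ X] [FiniteDimensional ℝ Y]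

/-- The adjoint `∇g(x)* : Y → X` of the derivative of `g` at `x`. -/
def adjDeriv (g : X → Y) (x : X) : Y →L[ℝ] X :=
  ContinuousLinearMap.adjoint (fderiv ℝ g x)

/-- `ker ∇g(x)*`. -/
def kerAdjDeriv (g : X → Y) (x : X) : Set Y :=
  {y | adjDeriv g x y = 0}

/-- `∇²⟨ys, g⟩(x)(u)`, identified with an element of `X`: the derivative at `x` in direction `u`
of the gradient of the scalarization `⟨ys, g⟩`. -/
def scalarHess (ys : Y) (g : X → Y) (x u : X) : X :=
  fderiv ℝ (gradient (fun x' => (inner ℝ ys (g x') : ℝ))) x u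

/-- `∇²g(x)[u, u] = ∑ᵢ ⟪u, ∇²⟨eᵢ, g⟩(x)(u)⟫ eᵢ` for `g` with values in `ℝᵐ`. -/
def secondDeriv {m : ℕ} (g : X → EuclideanSpace ℝ (Fin m)) (x u : X) :
    EuclideanSpace ℝ (Fin m) :=
  ∑ i, (inner ℝ u (scalarHess (EuclideanSpace.single i (1 : ℝ)) g x u) : ℝ) •
    EuclideanSpace.single i (1 : ℝ)

/-- `𝐓(u) = T_{T_D(g(x))}(∇g(x)u)`. -/
def bigT {m : ℕ} (g : X → EuclideanSpace ℝ (Fin m)) (D : Set (EuclideanSpace ℝ (Fin m)))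
    (x u : X) : Set (EuclideanSpace ℝ (Fin m)) :=
  tangentCone (tangentCone D (g x)) (fderiv ℝ g x u)

/-- `w_s(u, v) = ∇g(x)s + 1/2 ∇²g(x)[u, u] - v`. -/
def wVec {m : ℕ} (g : X → EuclideanSpace ℝ (Fin m)) (x s u : X)
    (v : EuclideanSpace ℝ (Fin m)) : EuclideanSpace ℝ (Fin m) :=
  fderiv ℝ g x s + (1 / 2 : ℝ) • secondDeriv g x u - v

end Maps

end VarAnalysis

end

open VarAnalysis

/-! A regular normal to the graph of x ↦ g(x) - D at (x, w) has the form (∇g(x)*η, -η) with η a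
regular normal to D at g(x) - w. With τ_k = t_k‖u_k‖, the coderivative condition thus yields x*_k =
τ_k⁻¹ ∇g(x_k)* y*_k with y*_k regular normals to D. Multiplying by τ_k gives ∇g(x̄)* y* = 0 in the
limit, and expanding ∇g(x_k) to first order gives ∇g(x̄)*(τ_k⁻¹(y*_k - y*)) → x* - ∇²⟨y*, g⟩(x̄)(u)
(`tendsto_adjDeriv_quotient`). It remains to realise this limit as ∇g(x̄)* z* with good z*, although
the quotients τ_k⁻¹(y*_k - y*) may be unbounded.

For arbitrary D, the range of ∇g(x̄)* is closed, and z* can be made orthogonal to y* because y* lies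
in the kernel. For a multiplier in the graphical derivative, either the quotients have a cluster
point, or normalizing them produces a unit kernel vector of exactly the kind that each regularity
condition forbids (`exists_mem_graphicalDeriv_or`).

For polyhedral D boundedness is replaced by the closedness of linear images of polyhedra
(`exists_mem_polyhedron_of_tendsto`). Signs of the finitely many defining affine functions cut space
into cells on which the regular normal cone is constant, so a subsequence of the y*_k lies in one
polyhedral cone C. The quotients lie in C - ℝ₊y*, whose linear images are closed, and its elements
are tangent to C at y*. The same closedness supplies the vector s in the second-order case, where
(u_k - u)/t_k need not converge (`exists_mem_tangentCone_limNormalCone_polySet`). -/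

namespace VarAnalysis

/-! ### Closedness of linear images of polyhedra, and Farkas' lemma. -/

section PolyhedralImages

variable {V W E : Type*}

/-- The image of a convex polyhedron in a Euclidean space under a linear map is (sequentially)
closed. -/
theorem exists_mem_polyhedron_of_tendsto_euclidean [NormedAddCommGroup V] [InnerProductSpace ℝ V]
    [FiniteDimensional ℝ V] [NormedAddCommGroup W] [NormedSpace ℝ W] (L : V →L[ℝ] W)
    {ι : Type*} [Finite ι] (f : ι → V →L[ℝ] ℝ) (c : ι → ℝ) (v : ℕ → V) (b : W)
    (hv : ∀ k i, f i (v k) ≤ c i) (hL : Tendsto (fun k => L (v k)) atTop (𝓝 b)) :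
    ∃ z, (∀ i, f i z ≤ c i) ∧ L z = b := by
  have hclosed : IsClosed {z | ∀ i, f i z ≤ c i} := by
    simp only [Set.ofPred_forall]
    exact isClosed_iInter fun i => isClosed_le (f i).continuous continuous_const
  -- Preimages of least norm are used: if they are unbounded, their normalized limit w is a
  -- recession direction in the kernel of L, and subtracting w gives a shorter feasible preimage.
  have hmin : ∀ k, ∃ m, (∀ i, f i m ≤ c i) ∧ L m = L (v k) ∧
      ∀ z, (∀ i, f i z ≤ c i) → L z = L (v k) → ‖m‖ ≤ ‖z‖ := by
    intro k
    have hcl : IsClosed ({z | ∀ i, f i z ≤ c i} ∩ {z | L z = L (v k)}) :=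
      hclosed.inter (isClosed_eq L.continuous continuous_const)
    obtain ⟨m, hm, hd⟩ := hcl.exists_infDist_eq_dist ⟨v k, hv k, rfl⟩ 0
    refine ⟨m, hm.1, hm.2, fun z hz hz' => ?_⟩
    have := Metric.infDist_le_dist_of_mem (x := (0 : V)) (show z ∈ {z | ∀ i, f i z ≤ c i} ∩ {z | L z = L (v k)} from ⟨hz, hz'⟩)
    rw [hd] at this
    simpa using this
  choose m hmP hmL hmm using hmin
  have hmb : Tendsto (fun k => L (m k)) atTop (𝓝 b) := by simpa only [hmL] using hL
  by_cases hbd : ∃ R, ∃ᶠ k in atTop, ‖m k‖ ≤ R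
  · obtain ⟨R, hR⟩ := hbd
    obtain ⟨z, -, φ, hφ, hz⟩ := tendsto_subseq_of_frequently_bounded
      (Metric.isBounded_closedBall (x := (0 : V)) (r := R))
      (hR.mono fun k hk => by simpa using hk)
    refine ⟨z, hclosed.mem_of_tendsto hz (Eventually.of_forall fun k => hmP _), ?_⟩
    exact tendsto_nhds_unique ((L.continuous.tendsto z).comp hz) (hmb.comp hφ.tendsto_atTop)
  · exfalso
    push Not at hbd
    have hinf : Tendsto (fun k => ‖m k‖) atTop atTop :=
      tendsto_atTop.2 fun R => (hbd R).mono fun k hk => hk.le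
    obtain ⟨w, hw, φ, hφ, hφw⟩ := (isCompact_closedBall (0 : V) 1).tendsto_subseq
      (x := fun k => ‖m k‖⁻¹ • m k) (fun k => by
        simp only [mem_closedBall_zero_iff, norm_smul, norm_inv, norm_norm]
        exact inv_mul_le_one)
    have hinfφ := hinf.comp hφ.tendsto_atTop
    have hpos : ∀ᶠ k in atTop, 0 < ‖m (φ k)‖ := hinfφ.eventually_gt_atTop 0
    have hinv : Tendsto (fun k => ‖m (φ k)‖⁻¹) atTop (𝓝 0) := tendsto_inv_atTop_zero.comp hinfφ
    have hw1 : ‖w‖ = 1 := by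
      refine tendsto_nhds_unique hφw.norm (tendsto_const_nhds.congr' ?_)
      filter_upwards [hpos] with k hk
      simp [norm_smul, inv_mul_cancel₀ hk.ne']
    have hLw : L w = 0 := by
      refine tendsto_nhds_unique ((L.continuous.tendsto w).comp hφw) ?_
      simpa [Function.comp_def] using hinv.smul (hmb.comp hφ.tendsto_atTop)
    have hfw : ∀ i, f i w ≤ 0 := by
      intro i
      have h2 : Tendsto (fun k => ‖m (φ k)‖⁻¹ * c i) atTop (𝓝 0) := by
        simpa using hinv.mul_const (c i)
      refine le_of_tendsto_of_tendsto' (((f i).continuous.tendsto w).comp hφw) h2 fun k => ?_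
      simp only [Function.comp_apply, map_smul, smul_eq_mul]
      exact mul_le_mul_of_nonneg_left (hmP _ i) (by positivity)
    have hrec : ∀ᶠ k in atTop, m (φ k) = ‖m (φ k)‖ • ‖m (φ k)‖⁻¹ • m (φ k) := by
      filter_upwards [hpos] with k hk
      rw [smul_smul, mul_inv_cancel₀ hk.ne', one_smul]
    -- If f i w = 0 the i-th constraint does not notice the shift by w; if f i w < 0 then f i (m (φ
    -- k)) tends to -∞ and leaves room for it.
    have hslack : ∀ i, ∀ᶠ k in atTop, f i (m (φ k) - w) ≤ c i := by
      intro i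
      rcases (hfw i).eq_or_lt with h0 | h0
      · exact Eventually.of_forall fun k => by simpa [h0] using hmP (φ k) i
      · have := hinfφ.atTop_mul_neg h0 (((f i).continuous.tendsto w).comp hφw)
        filter_upwards [this.eventually_le_atBot (c i + f i w), hrec] with k hk hk2
        rw [map_sub, sub_le_iff_le_add, hk2, map_smul, smul_eq_mul]
        exact hk
    have hinner : ∀ᶠ k in atTop, (1 : ℝ) < inner ℝ (m (φ k)) w := by
      have h1 : Tendsto (fun k => (inner ℝ (‖m (φ k)‖⁻¹ • m (φ k)) w : ℝ)) atTop
          (𝓝 (inner ℝ w w)) := hφw.inner tendsto_const_nhds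
      have := hinfφ.atTop_mul_pos (by rw [real_inner_self_eq_norm_sq, hw1]; norm_num) h1
      filter_upwards [this.eventually_gt_atTop 1, hrec] with k hk hk2
      rw [hk2, real_inner_smul_left]
      exact hk
    obtain ⟨k, hk1, hk2⟩ := ((eventually_all.2 hslack).and hinner).exists
    have h3 := hmm (φ k) (m (φ k) - w) hk1 (by rw [map_sub, hLw, sub_zero, hmL])
    have h4 := norm_sub_sq_real (m (φ k)) w
    rw [hw1] at h4
    have h5 := pow_le_pow_left₀ (norm_nonneg _) h3 2
    linarith

/-- The image of a convex polyhedron under a linear map is (sequentially) closed. -/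
theorem exists_mem_polyhedron_of_tendsto [NormedAddCommGroup V] [NormedSpace ℝ V]
    [FiniteDimensional ℝ V] [NormedAddCommGroup W] [NormedSpace ℝ W] (L : V →L[ℝ] W)
    {ι : Type*} [Finite ι] (f : ι → V →L[ℝ] ℝ) (c : ι → ℝ) (v : ℕ → V) (b : W)
    (hv : ∀ k i, f i (v k) ≤ c i) (hL : Tendsto (fun k => L (v k)) atTop (𝓝 b)) :
    ∃ z, (∀ i, f i z ≤ c i) ∧ L z = b := by
  -- The least-norm argument needs an inner product, whereas the applications live in products with
  -- the sup norm.
  let e : V ≃L[ℝ] EuclideanSpace ℝ (Fin (Module.finrank ℝ V)) := toEuclidean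
  obtain ⟨z, hz, hz'⟩ := exists_mem_polyhedron_of_tendsto_euclidean
    (L.comp (e.symm : EuclideanSpace ℝ (Fin (Module.finrank ℝ V)) →L[ℝ] V))
    (fun i => (f i).comp (e.symm : EuclideanSpace ℝ (Fin (Module.finrank ℝ V)) →L[ℝ] V)) c
    (fun k => e (v k)) b (by simpa using hv) (by simpa using hL)
  exact ⟨e.symm z, hz, hz'⟩

variable [NormedAddCommGroup E] [InnerProductSpace ℝ E]

/-- The convex cone generated by a finite family of vectors. -/
def finCone {κ : Type*} [Fintype κ] (a : κ → E) : Set E :=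
  {η | ∃ l : κ → ℝ, (∀ k, 0 ≤ l k) ∧ η = ∑ k, l k • a k}

theorem isClosed_finCone {κ : Type*} [Fintype κ] (a : κ → E) : IsClosed (finCone a) := by
  refine IsSeqClosed.isClosed fun η b hη hb => ?_
  choose l hl hη using hη
  obtain ⟨z, hz, hz'⟩ := exists_mem_polyhedron_of_tendsto
    (∑ k, (ContinuousLinearMap.proj (R := ℝ) (φ := fun _ : κ => ℝ) k).smulRight (a k))
    (fun k => -ContinuousLinearMap.proj (R := ℝ) (φ := fun _ : κ => ℝ) k) (fun _ => 0) l b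
    (fun k i => by simpa using hl k i) (by simpa [← hη] using hb)
  exact ⟨z, fun k => by simpa using hz k, by simp [← hz']⟩

/-- **Farkas' lemma**. -/
theorem mem_finCone_of_forall [FiniteDimensional ℝ E] {κ : Type*} [Fintype κ] (a : κ → E) (η : E)
    (h : ∀ w, (∀ k, (inner ℝ (a k) w : ℝ) ≤ 0) → (inner ℝ η w : ℝ) ≤ 0) : η ∈ finCone a := by
  classical
  let C : ProperCone ℝ E :=
    { carrier := finCone a
      add_mem' := by
        rintro x y ⟨l, hl, rfl⟩ ⟨l', hl', rfl⟩
        exact ⟨fun k => l k + l' k, fun k => add_nonneg (hl k) (hl' k), by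
          simp [add_smul, Finset.sum_add_distrib]⟩
      zero_mem' := ⟨fun _ => 0, fun _ => le_rfl, by simp⟩
      smul_mem' := by
        rintro r x ⟨l, hl, rfl⟩
        refine ⟨fun k => r * l k, fun k => mul_nonneg r.2 (hl k), ?_⟩
        rw [Finset.smul_sum]
        exact Finset.sum_congr rfl fun k _ => (smul_smul (r : ℝ) (l k) (a k))
      isClosed' := isClosed_finCone a }
  by_contra hη
  obtain ⟨y, hy, hy'⟩ := C.hyperplane_separation' (x₀ := η) hη
  have := h (-y) fun k => by
    have : 0 ≤ (inner ℝ (a k) y : ℝ) := hy (a k) ⟨Pi.single k 1, fun j => by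
      by_cases hj : j = k
      · subst hj; simp
      · simp [hj], by simp [Pi.single_apply]⟩
    simpa using this
  rw [inner_neg_right] at this
  linarith

/-- For a finite intersection `C` of finitely generated cones, the linear image of
`C - ℝ₊ y` is (sequentially) closed. -/
theorem exists_add_smul_mem_iInter_finCone [FiniteDimensional ℝ E]
    [NormedAddCommGroup W] [NormedSpace ℝ W] {ι : Type*} [Finite ι]
    {κ : ι → Type*} [∀ i, Fintype (κ i)] (a : ∀ i, κ i → E) (A : E →L[ℝ] W) (y : E) (b : W)
    (z : ℕ → E) (r : ℕ → ℝ) (hr : ∀ k, 0 ≤ r k) (hz : ∀ k i, z k + r k • y ∈ finCone (a i))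
    (hA : Tendsto (fun k => A (z k)) atTop (𝓝 b)) :
    ∃ (z' : E) (s : ℝ), 0 ≤ s ∧ A z' = b ∧ ∀ i, z' + s • y ∈ finCone (a i) := by
  have := Fintype.ofFinite ι
  choose l hl hzl using hz
  let V := E × (∀ i, κ i → ℝ) × ℝ
  let pl : V →L[ℝ] (∀ i, κ i → ℝ) :=
    (ContinuousLinearMap.fst ℝ _ _).comp (ContinuousLinearMap.snd ℝ _ _)
  let ps : V →L[ℝ] ℝ := (ContinuousLinearMap.snd ℝ _ _).comp (ContinuousLinearMap.snd ℝ _ _)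
  let pz : V →L[ℝ] E := ContinuousLinearMap.fst ℝ _ _
  let pc : ∀ p : (Σ i, κ i), V →L[ℝ] ℝ := fun p =>
    (ContinuousLinearMap.proj (R := ℝ) (φ := fun _ : κ p.1 => ℝ) p.2).comp
      ((ContinuousLinearMap.proj (R := ℝ) (φ := fun i => κ i → ℝ) p.1).comp pl)
  -- The zero set of G encodes all the representations z + s • y = ∑ l • a at once. G becomes part
  -- of the linear map, so that the polyhedron is given just by the sign conditions on l and s.
  let G : V →L[ℝ] (ι → E) := ContinuousLinearMap.pi fun i =>
    pz + ps.smulRight y - ∑ k, (pc ⟨i, k⟩).smulRight (a i k)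
  have hpc : ∀ p v, pc p v = v.2.1 p.1 p.2 := fun _ _ => rfl
  have hps : ∀ v, ps v = v.2.2 := fun _ => rfl
  have hpz : ∀ v, pz v = v.1 := fun _ => rfl
  have hG : ∀ v i, G v i = v.1 + v.2.2 • y - ∑ k, v.2.1 i k • a i k := fun v i => by
    simp [G, hpc, hps, hpz]
  obtain ⟨⟨z', l', s⟩, hv, hv'⟩ := exists_mem_polyhedron_of_tendsto ((A.comp pz).prod G)
    (fun o : Option (Σ i, κ i) => o.elim (-ps) (fun p => -pc p)) (fun _ => 0)
    (fun k => ((z k, l k, r k) : V)) (b, 0)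
    (by
      rintro k (_ | p)
      · change -r k ≤ 0
        simpa using hr k
      · change -l k p.1 p.2 ≤ 0
        simpa using hl k p.1 p.2)
    (by
      refine Tendsto.prodMk_nhds hA (tendsto_const_nhds.congr fun k => ?_)
      funext i
      rw [ContinuousLinearMap.coe_coe, hG]
      simp [hzl k i])
  refine ⟨z', s, neg_nonpos.1 (hv none), congrArg Prod.fst hv', fun i =>
    ⟨l' i, fun k => neg_nonpos.1 (hv (some ⟨i, k⟩)), ?_⟩⟩
  have hv2 : G (z', l', s) i = 0 := congrFun (congrArg Prod.snd hv') i
  rw [hG] at hv2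
  exact sub_eq_zero.1 hv2

end PolyhedralImages

/-! ### Tangent and regular normal cones of polyhedral sets. -/

section Polyhedral

variable {E : Type*} [NormedAddCommGroup E] [InnerProductSpace ℝ E]

/-- The union of the convex polyhedra given by finitely many finite systems of inequalities. -/
def polySet (𝓗 : Finset (Finset (E × ℝ))) : Set E :=
  {z | ∃ H ∈ 𝓗, ∀ h ∈ H, inner ℝ h.1 z ≤ h.2}

theorem IsPolyhedral.exists_eq_polySet {Q : Set E} (hQ : IsPolyhedral Q) :
    ∃ 𝓗 : Finset (Finset (E × ℝ)), Q = polySet 𝓗 := by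
  classical
  obtain ⟨S, hS, hP, rfl⟩ := hQ
  choose! H hH using hP
  refine ⟨hS.toFinset.image H, ?_⟩
  ext z
  simp only [Set.mem_sUnion, polySet, Finset.mem_image, Set.Finite.mem_toFinset, Set.mem_ofPred_eq,
    exists_exists_and_eq_and]
  refine exists_congr fun P => and_congr_right fun hPS => ?_
  conv_lhs => rw [hH P hPS]
  rfl

theorem isClosed_polySet (𝓗 : Finset (Finset (E × ℝ))) : IsClosed (polySet 𝓗) := by
  have : polySet 𝓗 = ⋃ H ∈ 𝓗, ⋂ h ∈ H, {z : E | inner ℝ h.1 z ≤ h.2} := by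
    ext z
    simp [polySet]
  rw [this]
  exact isClosed_biUnion_finset fun H _ => isClosed_biInter fun h _ =>
    isClosed_le (continuous_const.inner continuous_id) continuous_const

open Classical in
/-- The systems of inequalities describing the tangent cone of `polySet 𝓗` at `e`. -/
noncomputable def tangentSystem (𝓗 : Finset (Finset (E × ℝ))) (e : E) :
    Finset (Finset (E × ℝ)) :=
  (𝓗.filter fun H => ∀ h ∈ H, inner ℝ h.1 e ≤ h.2).image
    fun H => (H.filter fun h => inner ℝ h.1 e = h.2).image fun h => (h.1, 0)

theorem mem_polySet_tangentSystem {𝓗 : Finset (Finset (E × ℝ))} {e w : E} :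
    w ∈ polySet (tangentSystem 𝓗 e) ↔ ∃ H ∈ 𝓗, (∀ h ∈ H, inner ℝ h.1 e ≤ h.2) ∧
      ∀ h ∈ H, inner ℝ h.1 e = h.2 → inner ℝ h.1 w ≤ 0 := by
  simp only [polySet, tangentSystem, Finset.mem_image, Finset.mem_filter, Set.mem_ofPred_eq]
  constructor
  · rintro ⟨_, ⟨H, ⟨hH, hf⟩, rfl⟩, h2⟩
    refine ⟨H, hH, hf, fun h hh he => h2 (h.1, 0) ?_⟩
    simp only [Finset.mem_image, Finset.mem_filter]
    exact ⟨h, ⟨hh, he⟩, rfl⟩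
  · rintro ⟨H, hH, hf, h2⟩
    refine ⟨_, ⟨H, ⟨hH, hf⟩, rfl⟩, ?_⟩
    intro p hp
    simp only [Finset.mem_image, Finset.mem_filter] at hp
    obtain ⟨h, ⟨hh, he⟩, rfl⟩ := hp
    exact h2 h hh he

theorem smul_mem_polySet_tangentSystem {𝓗 : Finset (Finset (E × ℝ))} {e w : E} {t : ℝ}
    (ht : 0 < t) : t • w ∈ polySet (tangentSystem 𝓗 e) ↔ w ∈ polySet (tangentSystem 𝓗 e) := by
  simp only [mem_polySet_tangentSystem, real_inner_smul_right]
  have : ∀ a : ℝ, t * a ≤ 0 ↔ a ≤ 0 := fun a => by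
    rw [← mul_zero t, mul_le_mul_iff_right₀ ht, mul_zero]
  simp only [this]

/-- Near e, inequalities that are strict or violated at e keep their status by continuity, so only
the active ones constrain w. -/
theorem eventually_add_mem_polySet_iff (𝓗 : Finset (Finset (E × ℝ))) (e : E) :
    ∀ᶠ w in 𝓝 (0 : E), e + w ∈ polySet 𝓗 ↔ w ∈ polySet (tangentSystem 𝓗 e) := by
  have key : ∀ h : E × ℝ, ∀ᶠ w in 𝓝 (0 : E), (inner ℝ h.1 (e + w) ≤ h.2 ↔
      inner ℝ h.1 e ≤ h.2 ∧ (inner ℝ h.1 e = h.2 → inner ℝ h.1 w ≤ 0)) := by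
    intro h
    have hc : Tendsto (fun w : E => (inner ℝ h.1 (e + w) : ℝ)) (𝓝 0) (𝓝 (inner ℝ h.1 e)) := by
      have : Continuous fun w : E => (inner ℝ h.1 (e + w) : ℝ) :=
        continuous_const.inner (continuous_const.add continuous_id)
      simpa using this.tendsto 0
    rcases lt_trichotomy (inner ℝ h.1 e : ℝ) h.2 with h1 | h1 | h1
    · filter_upwards [hc.eventually (gt_mem_nhds h1)] with w hw
      exact ⟨fun _ => ⟨h1.le, fun h2 => absurd h2 h1.ne⟩, fun _ => hw.le⟩
    · refine Eventually.of_forall fun w => ?_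
      rw [inner_add_right, h1]
      simp
    · filter_upwards [hc.eventually (lt_mem_nhds h1)] with w hw
      exact ⟨fun h2 => absurd h2 hw.not_ge, fun h2 => absurd h2.1 h1.not_ge⟩
  have key2 : ∀ᶠ w in 𝓝 (0 : E), ∀ H ∈ 𝓗, ∀ h ∈ H, (inner ℝ h.1 (e + w) ≤ h.2 ↔
      inner ℝ h.1 e ≤ h.2 ∧ (inner ℝ h.1 e = h.2 → inner ℝ h.1 w ≤ 0)) :=
    (Finset.eventually_all _).2 fun H _ => (Finset.eventually_all _).2 fun h _ => key h
  filter_upwards [key2] with w hw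
  rw [mem_polySet_tangentSystem]
  refine exists_congr fun H => and_congr_right fun hH => ?_
  rw [← forall₂_and]
  exact forall₂_congr fun h hh => hw H hH h hh

/-- Rescaling moves the directions `dk` into T, and closedness keeps their limit there; conversely a
direction in T is realised by the constant sequence with small steps. -/
theorem tangentCone_eq_of_eventually {Q T : Set E} {e : E} (he : e ∈ Q)
    (hev : ∀ᶠ w in 𝓝 (0 : E), e + w ∈ Q ↔ w ∈ T) (hT : IsClosed T)
    (hcone : ∀ (w : E) (t : ℝ), 0 < t → (t • w ∈ T ↔ w ∈ T)) : tangentCone Q e = T := by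
  ext d
  constructor
  · rintro ⟨-, dk, t, hd, ht, ht0, hQ⟩
    have h0 : Tendsto (fun k => t k • dk k) atTop (𝓝 0) := by simpa using ht0.smul hd
    refine hT.mem_of_tendsto hd ?_
    filter_upwards [h0.eventually hev] with k hk
    exact (hcone _ _ (ht k)).1 (hk.1 (hQ k))
  · intro hd
    have ht0 : Tendsto (fun k : ℕ => 1 / ((k : ℝ) + 1)) atTop (𝓝 0) :=
      tendsto_one_div_add_atTop_nhds_zero_nat
    have h0 : Tendsto (fun k : ℕ => (1 / ((k : ℝ) + 1)) • d) atTop (𝓝 0) := by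
      simpa using ht0.smul_const d
    obtain ⟨N, hN⟩ := eventually_atTop.1 (h0.eventually hev)
    refine ⟨he, fun _ => d, fun k => 1 / (((k + N : ℕ) : ℝ) + 1), tendsto_const_nhds,
      fun k => by positivity, ht0.comp (tendsto_add_atTop_nat N), fun k => ?_⟩
    exact (hN (k + N) (Nat.le_add_left _ _)).2 ((hcone _ _ (by positivity)).2 hd)

theorem tangentCone_polySet {𝓗 : Finset (Finset (E × ℝ))} {e : E} (he : e ∈ polySet 𝓗) :
    tangentCone (polySet 𝓗) e = polySet (tangentSystem 𝓗 e) :=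
  tangentCone_eq_of_eventually he (eventually_add_mem_polySet_iff 𝓗 e) (isClosed_polySet _)
    fun _ _ => smul_mem_polySet_tangentSystem

/-- The homothety d' ↦ p + t • (d' - d) multiplies both sides of the defining inequality by t. Its
inverse gives the opposite inclusion. -/
theorem regNormalCone_subset_of_eventually {Q T : Set E} {p d : E} {t : ℝ} (ht : 0 < t)
    (h : ∀ᶠ d' in 𝓝 d, p + t • (d' - d) ∈ Q ↔ d' ∈ T) :
    regNormalCone Q p ⊆ regNormalCone T d := by
  rintro η ⟨hp, hη⟩
  refine ⟨h.self_of_nhds.1 (by simpa using hp), fun ε hε => ?_⟩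
  have hc : Tendsto (fun d' => p + t • (d' - d)) (𝓝[T] d) (𝓝[Q] p) := by
    refine tendsto_nhdsWithin_iff.2 ⟨?_, ?_⟩
    · have : Continuous fun d' => p + t • (d' - d) := by fun_prop
      simpa using (this.tendsto d).mono_left nhdsWithin_le_nhds
    · filter_upwards [h.filter_mono nhdsWithin_le_nhds, self_mem_nhdsWithin] with d' h1 h2
      exact h1.2 h2
  filter_upwards [hc.eventually (hη ε hε)] with d' hd'
  rw [add_sub_cancel_left, real_inner_smul_right, norm_smul, Real.norm_of_nonneg ht.le,
    mul_left_comm] at hd'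
  exact le_of_mul_le_mul_left hd' ht

/-- Regular normal cones are local and invariant under homotheties. -/
theorem regNormalCone_eq_of_eventually {Q T : Set E} {p d : E} {t : ℝ} (ht : 0 < t)
    (h : ∀ᶠ d' in 𝓝 d, p + t • (d' - d) ∈ Q ↔ d' ∈ T) :
    regNormalCone Q p = regNormalCone T d := by
  refine (regNormalCone_subset_of_eventually ht h).antisymm
    (regNormalCone_subset_of_eventually (inv_pos.2 ht) ?_)
  have hc : Tendsto (fun p' => d + t⁻¹ • (p' - p)) (𝓝 p) (𝓝 d) := by
    have : Continuous fun p' => d + t⁻¹ • (p' - p) := by fun_prop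
    simpa using this.tendsto p
  filter_upwards [hc.eventually h] with p' hp'
  rw [← hp', add_sub_cancel_left, smul_smul, mul_inv_cancel₀ ht.ne', one_smul,
    add_sub_cancel]

theorem mem_regNormalCone_zero_iff {T : Set E} (h0 : (0 : E) ∈ T)
    (hcone : ∀ (w : E) (t : ℝ), 0 < t → w ∈ T → t • w ∈ T) {η : E} :
    η ∈ regNormalCone T 0 ↔ ∀ w ∈ T, inner ℝ η w ≤ 0 := by
  constructor
  · rintro ⟨-, hη⟩ w hw
    refine le_of_forall_pos_le_add fun ε hε => ?_
    have hε' : 0 < ε / (‖w‖ + 1) := by positivity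
    have hc : Tendsto (fun k : ℕ => (1 / ((k : ℝ) + 1)) • w) atTop (𝓝[T] 0) := by
      refine tendsto_nhdsWithin_iff.2 ⟨?_, Eventually.of_forall fun k =>
        hcone _ _ (by positivity) hw⟩
      simpa using (tendsto_one_div_add_atTop_nhds_zero_nat (𝕜 := ℝ)).smul_const w
    obtain ⟨k, hk⟩ := (hc.eventually (hη _ hε')).exists
    have ht : (0 : ℝ) < 1 / ((k : ℝ) + 1) := by positivity
    rw [sub_zero, real_inner_smul_right, norm_smul, Real.norm_of_nonneg ht.le,
      mul_left_comm] at hk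
    refine (le_of_mul_le_mul_left hk ht).trans ?_
    rw [zero_add, div_mul_eq_mul_div, div_le_iff₀ (by positivity)]
    nlinarith [norm_nonneg w]
  · intro h
    refine ⟨h0, fun ε hε => ?_⟩
    filter_upwards [self_mem_nhdsWithin] with w hw
    rw [sub_zero]
    exact (h w hw).trans (by positivity)

theorem mem_regNormalCone_polySet_iff {𝓗 : Finset (Finset (E × ℝ))} {e η : E}
    (he : e ∈ polySet 𝓗) : η ∈ regNormalCone (polySet 𝓗) e ↔
      ∀ w ∈ polySet (tangentSystem 𝓗 e), inner ℝ η w ≤ 0 := by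
  have hev := eventually_add_mem_polySet_iff 𝓗 e
  rw [regNormalCone_eq_of_eventually (d := 0) one_pos (T := polySet (tangentSystem 𝓗 e))
    (by simpa using hev)]
  exact mem_regNormalCone_zero_iff (hev.self_of_nhds.1 (by simpa using he))
    fun _ _ ht => (smul_mem_polySet_tangentSystem ht).2

/-- Regular normal cones to polyhedral sets are finite intersections of finitely generated
cones. -/
theorem mem_regNormalCone_polySet_iff_finCone [FiniteDimensional ℝ E]
    {𝓗 : Finset (Finset (E × ℝ))} {e η : E} (he : e ∈ polySet 𝓗) :
    η ∈ regNormalCone (polySet 𝓗) e ↔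
      ∀ H : {H // H ∈ 𝓗 ∧ ∀ h ∈ H, (inner ℝ h.1 e : ℝ) ≤ h.2},
        η ∈ finCone fun h : {h : H.1 // (inner ℝ h.1.1 e : ℝ) = h.1.2} => h.1.1.1 := by
  rw [mem_regNormalCone_polySet_iff he]
  constructor
  · rintro h ⟨H, hH, hf⟩
    refine mem_finCone_of_forall _ _ fun w hw => h w (mem_polySet_tangentSystem.2
      ⟨H, hH, hf, fun p hp hpe => hw ⟨⟨p, hp⟩, hpe⟩⟩)
  · intro h w hw
    obtain ⟨H, hH, hf, hw⟩ := mem_polySet_tangentSystem.1 hw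
    obtain ⟨l, hl, rfl⟩ := h ⟨H, hH, hf⟩
    rw [sum_inner]
    refine Finset.sum_nonpos fun p _ => ?_
    rw [real_inner_smul_left]
    exact mul_nonpos_of_nonneg_of_nonpos (hl p) (hw _ p.1.2 p.2)

/-- The signs determine which systems hold and which inequalities are active, hence the tangent
cone, and its polar is the regular normal cone. Regular normals are therefore constant on sign
cells. -/
theorem regNormalCone_polySet_congr {𝓗 : Finset (Finset (E × ℝ))} {e e' : E}
    (he : e ∈ polySet 𝓗) (h : ∀ H ∈ 𝓗, ∀ h ∈ H,
      SignType.sign (inner ℝ h.1 e' - h.2 : ℝ) = SignType.sign (inner ℝ h.1 e - h.2 : ℝ)) :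
    e' ∈ polySet 𝓗 ∧ regNormalCone (polySet 𝓗) e' = regNormalCone (polySet 𝓗) e := by
  have hle : ∀ H ∈ 𝓗, ∀ p ∈ H, ((inner ℝ p.1 e' : ℝ) ≤ p.2 ↔ (inner ℝ p.1 e : ℝ) ≤ p.2) := by
    intro H hH p hp
    rw [← sub_nonpos, ← sign_nonpos_iff, h H hH p hp, sign_nonpos_iff, sub_nonpos]
  have heq : ∀ H ∈ 𝓗, ∀ p ∈ H, ((inner ℝ p.1 e' : ℝ) = p.2 ↔ (inner ℝ p.1 e : ℝ) = p.2) := by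
    intro H hH p hp
    rw [← sub_eq_zero, ← sign_eq_zero_iff, h H hH p hp, sign_eq_zero_iff, sub_eq_zero]
  have he' : e' ∈ polySet 𝓗 := by
    obtain ⟨H, hH, hf⟩ := he
    exact ⟨H, hH, fun p hp => (hle H hH p hp).2 (hf p hp)⟩
  refine ⟨he', ?_⟩
  ext η
  rw [mem_regNormalCone_polySet_iff he, mem_regNormalCone_polySet_iff he']
  refine forall_congr' fun w => imp_congr ?_ Iff.rfl
  rw [mem_polySet_tangentSystem, mem_polySet_tangentSystem]
  refine exists_congr fun H => and_congr_right fun hH => and_congr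
    (forall₂_congr (hle H hH)) (forall₂_congr fun p hp => imp_congr (heq H hH p hp) Iff.rfl)

end Polyhedral

/-! ### Limits of difference quotients of normals to a polyhedral set. -/

section PolyhedralCore

variable {E X W : Type*} [NormedAddCommGroup E] [InnerProductSpace ℝ E]

theorem smul_mem_regNormalCone {Q : Set E} {x η : E} {r : ℝ} (hr : 0 < r)
    (h : η ∈ regNormalCone Q x) : r • η ∈ regNormalCone Q x := by
  refine ⟨h.1, fun ε hε => ?_⟩
  filter_upwards [h.2 (ε / r) (by positivity)] with x' hx'
  rw [real_inner_smul_left]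
  calc r * inner ℝ η (x' - x) ≤ r * (ε / r * ‖x' - x‖) := mul_le_mul_of_nonneg_left hx' hr.le
    _ = ε * ‖x' - x‖ := by field_simp

/-- Pigeonhole: there are only finitely many sign vectors. -/
theorem exists_subseq_sign_eq (𝓗 : Finset (Finset (E × ℝ))) (e : ℕ → E) :
    ∃ φ : ℕ → ℕ, StrictMono φ ∧ ∀ k, ∀ H ∈ 𝓗, ∀ h ∈ H,
      SignType.sign (inner ℝ h.1 (e (φ k)) - h.2 : ℝ) =
        SignType.sign (inner ℝ h.1 (e (φ 0)) - h.2 : ℝ) := by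
  classical
  obtain ⟨σ, hσ⟩ := Finite.exists_infinite_fiber
    fun (k : ℕ) (h : ↥(𝓗.biUnion id)) => SignType.sign (inner ℝ h.1.1 (e k) - h.1.2 : ℝ)
  obtain ⟨φ, hφ, hφ'⟩ := extraction_of_frequently_atTop
    (Nat.frequently_atTop_iff_infinite.2 (Set.infinite_coe_iff.1 hσ))
  refine ⟨φ, hφ, fun k H hH h hh => ?_⟩
  have hm : h ∈ 𝓗.biUnion id := Finset.mem_biUnion.2 ⟨H, hH, hh⟩
  exact (congrFun (hφ' k) ⟨h, hm⟩).trans (congrFun (hφ' 0) ⟨h, hm⟩).symm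

/-- If `e k` runs through a cell (given by the signs of finitely many affine functions), then a
limit of `e k - B (s k)` is of the form `e' - B s'` with `e'` in the closure of the cell. -/
theorem exists_mem_closure_cell [FiniteDimensional ℝ E] [NormedAddCommGroup X] [NormedSpace ℝ X]
    [FiniteDimensional ℝ X] (𝓗 : Finset (Finset (E × ℝ))) (e : ℕ → E) (e₀ : E)
    (he : ∀ k, ∀ H ∈ 𝓗, ∀ h ∈ H, SignType.sign (inner ℝ h.1 (e k) - h.2 : ℝ) =
        SignType.sign (inner ℝ h.1 e₀ - h.2 : ℝ)) (B : X →L[ℝ] E) (s : ℕ → X) (w : E)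
    (hB : Tendsto (fun k => e k - B (s k)) atTop (𝓝 w)) :
    ∃ e' s', e' = w + B s' ∧ ∀ H ∈ 𝓗, ∀ h ∈ H,
      ((inner ℝ h.1 e₀ : ℝ) ≤ h.2 → (inner ℝ h.1 e' : ℝ) ≤ h.2) ∧
      (h.2 ≤ (inner ℝ h.1 e₀ : ℝ) → h.2 ≤ (inner ℝ h.1 e' : ℝ)) := by
  classical
  let F : ↥(𝓗.biUnion id) → E × X →L[ℝ] ℝ := fun h =>
    (innerSL ℝ h.1.1).comp (ContinuousLinearMap.fst ℝ E X)
  have hF : ∀ h p, F h p = inner ℝ h.1.1 p.1 := fun _ _ => rfl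
  have hle : ∀ k, ∀ h : ↥(𝓗.biUnion id), ((inner ℝ h.1.1 e₀ : ℝ) ≤ h.1.2 →
      (inner ℝ h.1.1 (e k) : ℝ) ≤ h.1.2) ∧ (h.1.2 ≤ (inner ℝ h.1.1 e₀ : ℝ) →
      h.1.2 ≤ (inner ℝ h.1.1 (e k) : ℝ)) := by
    rintro k ⟨h, hm⟩
    obtain ⟨H, hH, hh⟩ := Finset.mem_biUnion.1 hm
    have := he k H hH h hh
    constructor
    · intro h1
      rw [← sub_nonpos, ← sign_nonpos_iff] at h1 ⊢
      rwa [this]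
    · intro h1
      rw [← sub_nonneg, ← sign_nonneg_iff] at h1 ⊢
      rwa [this]
  -- Neither e k nor s k need be bounded, so compactness is of no use. The closed cell is a
  -- polyhedron (an equality enters once in each half of `Sum.elim`), and its image under (e, s) ↦ e
  -- - B s is closed.
  obtain ⟨⟨e', s'⟩, h1, h2⟩ := exists_mem_polyhedron_of_tendsto
    (ContinuousLinearMap.fst ℝ E X - B.comp (ContinuousLinearMap.snd ℝ E X))
    (Sum.elim (fun h : {h : ↥(𝓗.biUnion id) // (inner ℝ h.1.1 e₀ : ℝ) ≤ h.1.2} => F h.1)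
      (fun h : {h : ↥(𝓗.biUnion id) // h.1.2 ≤ (inner ℝ h.1.1 e₀ : ℝ)} => -F h.1))
    (Sum.elim (fun h => h.1.1.2) (fun h => -h.1.1.2)) (fun k => (e k, s k)) w
    (by
      rintro k (h | h)
      · exact (hle k h.1).1 h.2
      · exact neg_le_neg ((hle k h.1).2 h.2))
    hB
  refine ⟨e', s', ?_, fun H hH h hh => ?_⟩
  · have h3 : e' - B s' = w := h2
    rw [← h3, sub_add_cancel]
  · have hm : h ∈ 𝓗.biUnion id := Finset.mem_biUnion.2 ⟨H, hH, hh⟩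
    exact ⟨fun h3 => h1 (Sum.inl ⟨⟨h, hm⟩, h3⟩),
      fun h3 => neg_le_neg_iff.1 (h1 (Sum.inr ⟨⟨h, hm⟩, h3⟩))⟩

/-- Regular normals at a point of a cell are limiting normals at each point of its closure. -/
theorem regNormalCone_subset_limNormalCone_of_closure_cell {𝓗 : Finset (Finset (E × ℝ))}
    {e₀ e' : E} (he₀ : e₀ ∈ polySet 𝓗) (h : ∀ H ∈ 𝓗, ∀ h ∈ H,
      ((inner ℝ h.1 e₀ : ℝ) ≤ h.2 → (inner ℝ h.1 e' : ℝ) ≤ h.2) ∧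
      (h.2 ≤ (inner ℝ h.1 e₀ : ℝ) → h.2 ≤ (inner ℝ h.1 e' : ℝ))) :
    regNormalCone (polySet 𝓗) e₀ ⊆ limNormalCone (polySet 𝓗) e' := by
  intro η hη
  -- The half-open segment from e₀ towards e' stays in the cell of e₀; these points carry the same
  -- regular normals and converge to e'.
  let x : ℕ → E := fun j => e' + (1 / ((j : ℝ) + 1)) • (e₀ - e')
  have hx : Tendsto x atTop (𝓝 e') := by
    simpa [x] using (tendsto_const_nhds (x := e')).add
      ((tendsto_one_div_add_atTop_nhds_zero_nat (𝕜 := ℝ)).smul_const (e₀ - e'))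
  have hsign : ∀ j, ∀ H ∈ 𝓗, ∀ h ∈ H, SignType.sign (inner ℝ h.1 (x j) - h.2 : ℝ) =
      SignType.sign (inner ℝ h.1 e₀ - h.2 : ℝ) := by
    intro j H hH p hp
    obtain ⟨h1, h2⟩ := h H hH p hp
    have ht0 : (0 : ℝ) < 1 / ((j : ℝ) + 1) := by positivity
    have ht1 : 1 / ((j : ℝ) + 1) ≤ 1 := by
      rw [div_le_one (by positivity)]
      linarith [Nat.cast_nonneg (α := ℝ) j]
    have hval : (inner ℝ p.1 (x j) - p.2 : ℝ) = (1 - 1 / ((j : ℝ) + 1)) * (inner ℝ p.1 e' - p.2) +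
        1 / ((j : ℝ) + 1) * (inner ℝ p.1 e₀ - p.2) := by
      simp only [x, inner_add_right, real_inner_smul_right, inner_sub_right]
      ring
    rw [hval]
    generalize 1 / ((j : ℝ) + 1) = t at *
    rcases lt_trichotomy (inner ℝ p.1 e₀ : ℝ) p.2 with h3 | h3 | h3
    · have := mul_nonneg (sub_nonneg.2 ht1) (sub_nonneg.2 (h1 h3.le))
      have := mul_pos ht0 (sub_pos.2 h3)
      rw [sign_neg (by linarith), sign_neg (by linarith)]
    · have h4 : (inner ℝ p.1 e' : ℝ) = p.2 := le_antisymm (h1 h3.le) (h2 h3.ge)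
      simp [h3, h4]
    · have := mul_nonneg (sub_nonneg.2 ht1) (sub_nonneg.2 (h2 h3.le))
      have := mul_pos ht0 (sub_pos.2 h3)
      rw [sign_pos (by linarith), sign_pos (by linarith)]
  have hN := fun j => regNormalCone_polySet_congr he₀ (hsign j)
  refine ⟨(isClosed_polySet 𝓗).mem_of_tendsto hx (Eventually.of_forall fun j => (hN j).1),
    x, fun _ => η, hx, tendsto_const_nhds, fun j => ?_⟩
  rw [(hN j).2]
  exact hη

/-- The polyhedral limit argument: difference quotients of regular normals to a polyhedral set,
taken modulo a linear map, converge to the image of a tangent direction to the limiting normal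
cone at a suitable point. -/
theorem exists_mem_tangentCone_limNormalCone_polySet [FiniteDimensional ℝ E]
    [NormedAddCommGroup X] [NormedSpace ℝ X] [FiniteDimensional ℝ X]
    [NormedAddCommGroup W] [NormedSpace ℝ W] {𝓗 : Finset (Finset (E × ℝ))}
    {e η : ℕ → E} (hη : ∀ k, η k ∈ regNormalCone (polySet 𝓗) (e k)) {y : E}
    (hy : Tendsto η atTop (𝓝 y)) {τ : ℕ → ℝ} (hτ : ∀ k, 0 < τ k) (A : E →L[ℝ] W) {b : W}
    (hA : Tendsto (fun k => A ((τ k)⁻¹ • (η k - y))) atTop (𝓝 b))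
    (B : X →L[ℝ] E) (s : ℕ → X) {w : E} (hB : Tendsto (fun k => e k - B (s k)) atTop (𝓝 w)) :
    ∃ s', ∃ z ∈ tangentCone (limNormalCone (polySet 𝓗) (w + B s')) y,
      A z = b ∧ y ∈ limNormalCone (polySet 𝓗) (w + B s') := by
  obtain ⟨φ, hφ, hs⟩ := exists_subseq_sign_eq 𝓗 e
  have he₀ : e (φ 0) ∈ polySet 𝓗 := (hη (φ 0)).1
  obtain ⟨e', s', rfl, he'⟩ := exists_mem_closure_cell 𝓗 (fun k => e (φ k)) (e (φ 0)) hs B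
    (fun k => s (φ k)) w (hB.comp hφ.tendsto_atTop)
  have hsub := regNormalCone_subset_limNormalCone_of_closure_cell he₀ he'
  have hC : ∀ k, η (φ k) ∈ regNormalCone (polySet 𝓗) (e (φ 0)) := fun k => by
    rw [← (regNormalCone_polySet_congr he₀ (hs k)).2]
    exact hη _
  have hyC : y ∈ regNormalCone (polySet 𝓗) (e (φ 0)) := by
    rw [mem_regNormalCone_polySet_iff he₀]
    intro v hv
    exact le_of_tendsto' ((hy.comp hφ.tendsto_atTop).inner (tendsto_const_nhds (x := v)))
      fun k => (mem_regNormalCone_polySet_iff he₀).1 (hC k) v hv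
  have : Finite {H // H ∈ 𝓗 ∧ ∀ h ∈ H, (inner ℝ h.1 (e (φ 0)) : ℝ) ≤ h.2} :=
    Finite.Set.subset (𝓗 : Set (Finset (E × ℝ))) fun H hH => hH.1
  -- With C the regular normal cone of the common cell, τ⁻¹(η - y) + τ⁻¹y = τ⁻¹η lies in C, so the
  -- quotients belong to C - ℝ₊y.
  obtain ⟨z, r, hr, hz, hzC⟩ := exists_add_smul_mem_iInter_finCone
    (fun (H : {H // H ∈ 𝓗 ∧ ∀ h ∈ H, (inner ℝ h.1 (e (φ 0)) : ℝ) ≤ h.2})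
      (h : {h : H.1 // (inner ℝ h.1.1 (e (φ 0)) : ℝ) = h.1.2}) => h.1.1.1) A y b
    (fun k => (τ (φ k))⁻¹ • (η (φ k) - y)) (fun k => (τ (φ k))⁻¹)
    (fun k => (inv_pos.2 (hτ _)).le)
    (fun k => by
      rw [← smul_add, sub_add_cancel]
      exact (mem_regNormalCone_polySet_iff_finCone he₀).1
        (smul_mem_regNormalCone (inv_pos.2 (hτ _)) (hC k)))
    (hA.comp hφ.tendsto_atTop)
  have hzC' := (mem_regNormalCone_polySet_iff_finCone he₀).2 hzC
  -- The factor (1 + r)⁻¹ makes t r ≤ 1, so that y + t z = (1 - t r) y + t (z + r y) is a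
  -- nonnegative combination of elements of C.
  refine ⟨s', z, ⟨hsub hyC, fun _ => z, fun k => 1 / ((k : ℝ) + 1) * (1 + r)⁻¹,
    tendsto_const_nhds, fun k => by positivity, ?_, fun k => hsub ?_⟩, hz, hsub hyC⟩
  · simpa using (tendsto_one_div_add_atTop_nhds_zero_nat (𝕜 := ℝ)).mul_const (1 + r)⁻¹
  · beta_reduce
    rw [mem_regNormalCone_polySet_iff he₀] at hyC hzC' ⊢
    intro v hv
    have h1 := hyC v hv
    have h2 := hzC' v hv
    have ht0 : 0 ≤ 1 / ((k : ℝ) + 1) * (1 + r)⁻¹ := by positivity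
    have ht1 : 1 / ((k : ℝ) + 1) * (1 + r)⁻¹ * r ≤ 1 := by
      have h3 : 1 / ((k : ℝ) + 1) ≤ 1 := by
        rw [div_le_one (by positivity)]
        linarith [Nat.cast_nonneg (α := ℝ) k]
      have h4 : (1 + r)⁻¹ * r ≤ 1 := by
        rw [inv_mul_le_iff₀ (by positivity)]
        linarith
      rw [mul_assoc]
      exact mul_le_one₀ h3 (by positivity) h4
    generalize 1 / ((k : ℝ) + 1) * (1 + r)⁻¹ = t at *
    rw [inner_add_left, real_inner_smul_left] at h2 ⊢
    nlinarith [mul_nonneg (sub_nonneg.2 ht1) (neg_nonneg.2 h1), mul_nonneg ht0 (neg_nonneg.2 h2)]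

end PolyhedralCore

/-! ### Regular normals are polar to tangent directions. -/

section Normals

variable {E : Type*} [NormedAddCommGroup E] [InnerProductSpace ℝ E]

theorem inner_nonpos_of_mem_regNormalCone {Q : Set E} {p η w : E} (hη : η ∈ regNormalCone Q p)
    {d : ℕ → E} {t : ℕ → ℝ} (hd : Tendsto d atTop (𝓝 w)) (ht : ∀ k, 0 < t k)
    (ht0 : Tendsto t atTop (𝓝 0)) (hQ : ∀ k, p + t k • d k ∈ Q) : (inner ℝ η w : ℝ) ≤ 0 := by
  have hε : ∀ ε : ℝ, 0 < ε → (inner ℝ η w : ℝ) ≤ ε * ‖w‖ := by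
    intro ε hε
    have hp : Tendsto (fun k => p + t k • d k) atTop (𝓝[Q] p) := by
      refine tendsto_nhdsWithin_iff.2 ⟨?_, Eventually.of_forall hQ⟩
      simpa using tendsto_const_nhds.add (ht0.smul hd)
    refine le_of_tendsto_of_tendsto (tendsto_const_nhds.inner hd) (hd.norm.const_mul ε) ?_
    filter_upwards [hp.eventually (hη.2 ε hε)] with k hk
    rw [add_sub_cancel_left, real_inner_smul_right, norm_smul, Real.norm_of_nonneg (ht k).le,
      mul_left_comm] at hk
    exact le_of_mul_le_mul_left hk (ht k)
  refine le_of_forall_pos_le_add fun ε h => (hε (ε / (‖w‖ + 1)) (by positivity)).trans ?_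
  rw [zero_add, div_mul_eq_mul_div, div_le_iff₀ (by positivity)]
  nlinarith [norm_nonneg w]

end Normals

/-! ### Taylor expansions and normals to the graph of the constraint mapping. -/

section Calculus

variable {X Y : Type*} [NormedAddCommGroup X] [InnerProductSpace ℝ X]
  [NormedAddCommGroup Y] [InnerProductSpace ℝ Y]

theorem tendsto_clm_apply {X Y : Type*} [NormedAddCommGroup X] [NormedSpace ℝ X]
    [NormedAddCommGroup Y] [NormedSpace ℝ Y] {S : ℕ → X →L[ℝ] Y} {S' : X →L[ℝ] Y} {x : ℕ → X}
    {x' : X} (hS : Tendsto S atTop (𝓝 S')) (hx : Tendsto x atTop (𝓝 x')) :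
    Tendsto (fun k => S k (x k)) atTop (𝓝 (S' x')) :=
  (isBoundedBilinearMap_apply.continuous.tendsto (S', x')).comp (hS.prodMk_nhds hx)

theorem tendsto_inv_smul_sub {X Y : Type*} [NormedAddCommGroup X] [NormedSpace ℝ X]
    [NormedAddCommGroup Y] [NormedSpace ℝ Y] {f : X → Y} {f' : X →L[ℝ] Y} {x u : X}
    (hf : HasFDerivAt f f' x) {uk : ℕ → X} {t : ℕ → ℝ} (hu : Tendsto uk atTop (𝓝 u))
    (ht : ∀ k, 0 < t k) (ht0 : Tendsto t atTop (𝓝 0)) :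
    Tendsto (fun k => (t k)⁻¹ • (f (x + t k • uk k) - f x)) atTop (𝓝 (f' u)) := by
  refine (hasFDerivWithinAt_univ.2 hf).lim (by simpa using ht0.smul hu)
    (Eventually.of_forall fun _ => Set.mem_univ _) ?_
  simpa [smul_smul, inv_mul_cancel₀ (ht _).ne'] using hu

/-- Second-order Taylor expansion of a `C²` map. -/
theorem isLittleO_taylor_two {X Y : Type*} [NormedAddCommGroup X] [NormedSpace ℝ X]
    [NormedAddCommGroup Y] [NormedSpace ℝ Y] {g : X → Y} (hg : ContDiff ℝ 2 g) (x : X) :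
    (fun h => g (x + h) - g x - fderiv ℝ g x h - (1 / 2 : ℝ) • fderiv ℝ (fderiv ℝ g) x h h)
      =o[𝓝 0] fun h => ‖h‖ ^ 2 := by
  have hd1 : Differentiable ℝ g := hg.differentiable (by norm_num)
  have hd2 : Differentiable ℝ (fderiv ℝ g) :=
    (hg.fderiv_right (m := 1) (by norm_num)).differentiable (by norm_num)
  have ho := hasFDerivAt_iff_isLittleO_nhds_zero.1 (hd2 x).hasFDerivAt
  refine Asymptotics.isLittleO_iff.2 fun ε hε => ?_
  obtain ⟨r, hr, hball⟩ := Metric.eventually_nhds_iff_ball.1 (Asymptotics.isLittleO_iff.1 ho hε)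
  filter_upwards [Metric.ball_mem_nhds (0 : X) hr] with h hh
  -- At s = 1 minus its value at s = 0, this function is the Taylor remainder; its derivative on [0,
  -- 1) is at most ε‖h‖², so the mean value inequality suffices.
  have hder : ∀ s : ℝ, HasDerivAt (fun s : ℝ => g (x + s • h) - s • fderiv ℝ g x h -
      (s ^ 2 / 2) • fderiv ℝ (fderiv ℝ g) x h h)
      (fderiv ℝ g (x + s • h) h - fderiv ℝ g x h - s • fderiv ℝ (fderiv ℝ g) x h h) s := by
    intro s
    have h1 : HasDerivAt (fun s : ℝ => x + s • h) h s := by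
      simpa using ((hasDerivAt_id s).smul_const h).const_add x
    have h2 := (hd1 (x + s • h)).hasFDerivAt.comp_hasDerivAt s h1
    have h3 : HasDerivAt (fun s : ℝ => s • fderiv ℝ g x h) (fderiv ℝ g x h) s := by
      simpa using (hasDerivAt_id s).smul_const (fderiv ℝ g x h)
    have h4 : HasDerivAt (fun s : ℝ => (s ^ 2 / 2) • fderiv ℝ (fderiv ℝ g) x h h)
        (s • fderiv ℝ (fderiv ℝ g) x h h) s := by
      have h5 : HasDerivAt (fun s : ℝ => s ^ 2 / 2) s s := by
        simpa using ((hasDerivAt_pow 2 s).div_const 2)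
      exact h5.smul_const _
    exact (h2.sub h3).sub h4
  have hbound : ∀ s ∈ Set.Ico (0 : ℝ) 1, ‖fderiv ℝ g (x + s • h) h - fderiv ℝ g x h -
      s • fderiv ℝ (fderiv ℝ g) x h h‖ ≤ ε * ‖h‖ ^ 2 := by
    intro s hs
    have hn : ‖s • h‖ ≤ ‖h‖ := by
      rw [norm_smul, Real.norm_of_nonneg hs.1]
      exact mul_le_of_le_one_left (norm_nonneg _) hs.2.le
    have hsh : s • h ∈ Metric.ball (0 : X) r := by
      rw [mem_ball_zero_iff] at hh ⊢
      exact hn.trans_lt hh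
    have h1 := hball _ hsh
    have h2 : fderiv ℝ g (x + s • h) h - fderiv ℝ g x h - s • fderiv ℝ (fderiv ℝ g) x h h =
        (fderiv ℝ g (x + s • h) - fderiv ℝ g x - fderiv ℝ (fderiv ℝ g) x (s • h)) h := by
      simp
    rw [h2, pow_two, ← mul_assoc]
    refine (ContinuousLinearMap.le_opNorm _ _).trans ?_
    gcongr
    exact h1.trans (by gcongr)
  have := norm_image_sub_le_of_norm_deriv_le_segment_01'
    (fun s _ => (hder s).hasDerivWithinAt) hbound
  simp only [one_smul, zero_smul, add_zero, one_pow, sub_zero, ne_eq, OfNat.ofNat_ne_zero,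
    not_false_eq_true, zero_pow, zero_div] at this
  rw [norm_pow, norm_norm]
  refine le_trans (le_of_eq ?_) this
  congr 1
  abel

/-- The first-order term is evaluated at `uk k` rather than u, because `uk` converges without any
rate and (uk - u)/t may diverge. -/
theorem tendsto_second_order_quotient {X Y : Type*} [NormedAddCommGroup X] [NormedSpace ℝ X]
    [NormedAddCommGroup Y] [NormedSpace ℝ Y] {g : X → Y} (hg : ContDiff ℝ 2 g) {x u : X}
    {uk : ℕ → X} {t : ℕ → ℝ} (hu : Tendsto uk atTop (𝓝 u))
    (ht : ∀ k, 0 < t k) (ht0 : Tendsto t atTop (𝓝 0)) :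
    Tendsto (fun k => (t k ^ 2)⁻¹ • (g (x + t k • uk k) - g x - t k • fderiv ℝ g x (uk k)))
      atTop (𝓝 ((1 / 2 : ℝ) • fderiv ℝ (fderiv ℝ g) x u u)) := by
  have h0 : Tendsto (fun k => t k • uk k) atTop (𝓝 0) := by simpa using ht0.smul hu
  have hO : (fun k => ‖t k • uk k‖ ^ 2) =O[atTop] fun k => t k ^ 2 := by
    refine Asymptotics.IsBigO.pow ?_ 2
    refine Asymptotics.IsBigO.norm_left ?_
    simpa using (Asymptotics.isBigO_refl t atTop).smul (hu.isBigO_one ℝ)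
  have h1 := (((isLittleO_taylor_two hg x).comp_tendsto h0).trans_isBigO
    hO).tendsto_inv_smul_nhds_zero
  have hu' : Tendsto (fun k => fderiv ℝ (fderiv ℝ g) x (uk k)) atTop
      (𝓝 (fderiv ℝ (fderiv ℝ g) x u)) := ((fderiv ℝ (fderiv ℝ g) x).continuous.tendsto u).comp hu
  have h2 := (tendsto_clm_apply hu' hu).const_smul (1 / 2 : ℝ)
  have h3 := h1.add h2
  rw [zero_add] at h3
  refine h3.congr fun k => ?_
  simp only [Function.comp_apply, map_smul, smul_apply]
  rw [smul_sub ((t k ^ 2)⁻¹) (_ - _) ((1 / 2 : ℝ) • _), smul_comm (1 / 2 : ℝ) (t k),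
    smul_comm (1 / 2 : ℝ) (t k), smul_smul, smul_smul, mul_assoc, ← pow_two,
    inv_mul_cancel₀ (pow_pos (ht k) 2).ne', one_smul, sub_add_cancel]

variable [FiniteDimensional ℝ X] [FiniteDimensional ℝ Y]

/-- The gradient of ⟨y, g⟩ is ∇g(·)* y, a fixed linear image of ∇g(·), so differentiation passes
through it. -/
theorem scalarHess_eq {g : X → Y} (hg : ContDiff ℝ 2 g) (y : Y) (x u : X) :
    scalarHess y g x u =
      ContinuousLinearMap.adjoint (fderiv ℝ (fderiv ℝ g) x u) y := by
  have hd1 : Differentiable ℝ g := hg.differentiable (by norm_num)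
  have hd2 : Differentiable ℝ (fderiv ℝ g) :=
    (hg.fderiv_right (m := 1) (by norm_num)).differentiable (by norm_num)
  let J : (X →L[ℝ] Y) →L[ℝ] X := LinearMap.toContinuousLinearMap
    { toFun := fun T => ContinuousLinearMap.adjoint T y
      map_add' := fun S T => by simp
      map_smul' := fun r T => by simp }
  have hgrad : gradient (fun x' => (inner ℝ y (g x') : ℝ)) = fun x' => J (fderiv ℝ g x') := by
    funext x'
    refine HasGradientAt.gradient ?_
    rw [hasGradientAt_iff_hasFDerivAt]
    have h1 := (innerSL ℝ y).hasFDerivAt.comp x' (hd1 x').hasFDerivAt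
    refine h1.congr_fderiv ?_
    ext h
    simp [J, ContinuousLinearMap.adjoint_inner_left]
  rw [scalarHess, hgrad]
  have h2 := J.hasFDerivAt.comp x (hd2 x).hasFDerivAt
  exact congrArg (fun T : X →L[ℝ] X => T u) h2.fderiv

theorem secondDeriv_eq {m : ℕ} {g : X → EuclideanSpace ℝ (Fin m)} (hg : ContDiff ℝ 2 g)
    (x u : X) : secondDeriv g x u = fderiv ℝ (fderiv ℝ g) x u u := by
  ext i
  simp [secondDeriv, scalarHess_eq hg, ContinuousLinearMap.adjoint_inner_right,
    Pi.single_apply, EuclideanSpace.inner_single_right]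

/-- Regular normals to the graph of a constraint mapping. -/
theorem regNormalCone_gph_constraintMap {g : X → Y} {D : Set Y} {x a : X} {w b : Y}
    (hg : DifferentiableAt ℝ g x)
    (h : WithLp.toLp 2 (a, b) ∈ regNormalCone (gph (constraintMap g D)) (WithLp.toLp 2 (x, w))) :
    a = -adjDeriv g x b ∧ -b ∈ regNormalCone D (g x - w) := by
  obtain ⟨d, hd, hw⟩ : w ∈ constraintMap g D x := h.1
  change w = g x - d at hw
  have hd' : g x - w = d := by rw [hw, sub_sub_cancel]
  rw [hd']
  refine ⟨?_, hd, fun ε hε => ?_⟩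
  -- With d ∈ D held fixed, the curve s ↦ (x + s v, g(x + s v) - d) stays in the graph and has
  -- tangent (v, ∇g(x)v). Using ±v turns the inequality into an equality.
  · have key : ∀ v : X, (inner ℝ a v + inner ℝ b (fderiv ℝ g x v) : ℝ) ≤ 0 := by
      intro v
      have ht : ∀ k : ℕ, (0 : ℝ) < 1 / ((k : ℝ) + 1) := fun k => by positivity
      have ht0 := tendsto_one_div_add_atTop_nhds_zero_nat (𝕜 := ℝ)
      have h1 := tendsto_inv_smul_sub hg.hasFDerivAt (tendsto_const_nhds (x := v)) ht ht0
      have h2 := ((WithLp.prod_continuous_toLp 2 X Y).tendsto _).comp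
        ((tendsto_const_nhds (x := v)).prodMk_nhds h1)
      have h3 := inner_nonpos_of_mem_regNormalCone h h2 ht ht0 (fun k => by
        refine ⟨d, hd, ?_⟩
        change w + (1 / ((k : ℝ) + 1)) • ((1 / ((k : ℝ) + 1))⁻¹ •
          (g (x + (1 / ((k : ℝ) + 1)) • v) - g x)) = g (x + (1 / ((k : ℝ) + 1)) • v) - d
        rw [smul_smul, mul_inv_cancel₀ (ht k).ne', one_smul, hw]
        abel)
      simpa [WithLp.prod_inner_apply] using h3
    refine ext_inner_right ℝ fun v => ?_
    have h1 := key v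
    have h2 := key (-v)
    rw [map_neg, inner_neg_right, inner_neg_right] at h2
    rw [inner_neg_left, adjDeriv, ContinuousLinearMap.adjoint_inner_left]
    linarith
  -- Now x is held fixed and only the point of D moves, which isolates the second component.
  · have hc : Tendsto (fun d' => WithLp.toLp 2 (x, g x - d')) (𝓝[D] d)
        (𝓝[gph (constraintMap g D)] (WithLp.toLp 2 (x, w))) := by
      refine tendsto_nhdsWithin_iff.2 ⟨?_, ?_⟩
      · rw [hw]
        have : Continuous fun d' => WithLp.toLp 2 (x, g x - d') :=
          (WithLp.prod_continuous_toLp 2 X Y).comp (by fun_prop)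
        exact (this.tendsto d).mono_left nhdsWithin_le_nhds
      · filter_upwards [self_mem_nhdsWithin] with d' hd'
        exact ⟨d', hd', rfl⟩
    filter_upwards [hc.eventually (h.2 ε hε)] with d' hd'
    have hsub : WithLp.toLp 2 (x, g x - d') - WithLp.toLp 2 (x, w) =
        WithLp.toLp 2 ((0 : X), -(d' - d)) := by
      rw [← WithLp.toLp_sub, hw, Prod.mk_sub_mk, sub_self]
      congr 2
      abel
    have hnorm : ‖WithLp.toLp 2 ((0 : X), -(d' - d))‖ = ‖d' - d‖ := by
      simp [norm_sub_rev]
    rw [hsub, hnorm] at hd'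
    rw [inner_neg_left, ← inner_neg_right]
    simpa [WithLp.prod_inner_apply] using hd'

/-- Passage to the limit in the relation between normals to the graph and normals to `D`. -/
theorem tendsto_adjDeriv_quotient {g : X → Y} (hg : ContDiff ℝ 2 g) {x u xs : X} {ys : Y}
    (hu1 : ‖u‖ = 1) {uk xsk : ℕ → X} {ysk : ℕ → Y} {t : ℕ → ℝ}
    (hu : Tendsto uk atTop (𝓝 u)) (hu0 : ∀ k, 0 < ‖uk k‖) (ht : ∀ k, 0 < t k)
    (ht0 : Tendsto t atTop (𝓝 0)) (hxs : Tendsto xsk atTop (𝓝 xs))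
    (hys : Tendsto ysk atTop (𝓝 ys))
    (h : ∀ k, xsk k = (t k * ‖uk k‖)⁻¹ • adjDeriv g (x + t k • uk k) (ysk k)) :
    adjDeriv g x ys = 0 ∧
    Tendsto (fun k => adjDeriv g x ((t k * ‖uk k‖)⁻¹ • (ysk k - ys))) atTop
      (𝓝 (xs - scalarHess ys g x u)) := by
  have hd2 : Differentiable ℝ (fderiv ℝ g) :=
    (hg.fderiv_right (m := 1) (by norm_num)).differentiable (by norm_num)
  have hun : Tendsto (fun k => ‖uk k‖) atTop (𝓝 1) := by simpa [hu1] using hu.norm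
  have hτ0 : Tendsto (fun k => t k * ‖uk k‖) atTop (𝓝 0) := by simpa using ht0.mul hun
  have hτ : ∀ k, 0 < t k * ‖uk k‖ := fun k => mul_pos (ht k) (hu0 k)
  have hxk : Tendsto (fun k => x + t k • uk k) atTop (𝓝 x) := by
    simpa using (tendsto_const_nhds (x := x)).add (ht0.smul hu)
  have happly : ∀ {S : ℕ → X →L[ℝ] Y} {S' : X →L[ℝ] Y}, Tendsto S atTop (𝓝 S') →
      Tendsto (fun k => ContinuousLinearMap.adjoint (S k) (ysk k)) atTop
        (𝓝 (ContinuousLinearMap.adjoint S' ys)) := fun {S S'} hS => by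
    have hS' : Tendsto (fun k => ContinuousLinearMap.adjoint (S k)) atTop
        (𝓝 (ContinuousLinearMap.adjoint S')) :=
      ((ContinuousLinearMap.adjoint (𝕜 := ℝ) (E := X) (F := Y)).continuous.tendsto S').comp hS
    exact tendsto_clm_apply hS' hys
  have hker : adjDeriv g x ys = 0 := by
    have h1 := happly ((hd2.continuous.tendsto x).comp hxk)
    have h2 : Tendsto (fun k => (t k * ‖uk k‖) • xsk k) atTop (𝓝 0) := by
      simpa using hτ0.smul hxs
    refine tendsto_nhds_unique h1 (h2.congr fun k => ?_)
    rw [h k, smul_smul, mul_inv_cancel₀ (hτ k).ne', one_smul]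
    rfl
  refine ⟨hker, ?_⟩
  -- Subtracting from x*_k the term ‖u_k‖⁻¹(t_k⁻¹(∇g(x_k) - ∇g(x)))* y*_k, which tends to the
  -- Hessian term, leaves τ_k⁻¹∇g(x)* y*_k; y* may then be inserted because it lies in the kernel.
  have h1 := happly (tendsto_inv_smul_sub (hd2 x).hasFDerivAt hu ht ht0)
  have h2 := hxs.sub ((hun.inv₀ one_ne_zero).smul h1)
  rw [inv_one, one_smul, ← scalarHess_eq hg] at h2
  refine h2.congr fun k => ?_
  have h3 : ContinuousLinearMap.adjoint ((t k)⁻¹ • (fderiv ℝ g (x + t k • uk k) -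
      fderiv ℝ g x)) (ysk k) =
      (t k)⁻¹ • (adjDeriv g (x + t k • uk k) (ysk k) - adjDeriv g x (ysk k)) := by
    simp [adjDeriv]
  rw [h3, h k, map_smul, map_sub, hker, sub_zero, smul_smul, ← mul_inv_rev, smul_sub,
    sub_sub_cancel]

end Calculus

/-! ### Sets that are locally conic, and reduction to the tangent cone. -/

section Conic

variable {E : Type*} [NormedAddCommGroup E] [InnerProductSpace ℝ E]

theorem regNormalCone_subset_limNormalCone (Q : Set E) (x : E) :
    regNormalCone Q x ⊆ limNormalCone Q x := fun η hη =>
  ⟨hη.1, fun _ => x, fun _ => η, tendsto_const_nhds, tendsto_const_nhds, fun _ => hη⟩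

/-- If `D` coincides near `p` with `p + T` for a cone `T`, then so do the regular normals. -/
theorem eventually_regNormalCone_add_smul_eq {D T : Set E} {p : E}
    (hev : ∀ᶠ w in 𝓝 (0 : E), p + w ∈ D ↔ w ∈ T)
    (hcone : ∀ (w : E) (t : ℝ), 0 < t → (t • w ∈ T ↔ w ∈ T)) {d : ℕ → E} {t : ℕ → ℝ}
    (ht : ∀ k, 0 < t k) (htd : Tendsto (fun k => t k • d k) atTop (𝓝 0)) :
    ∀ᶠ k in atTop, regNormalCone D (p + t k • d k) = regNormalCone T (d k) := by
  filter_upwards [htd.eventually hev.eventually_nhds] with k hk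
  refine regNormalCone_eq_of_eventually (ht k) ?_
  have hc : Tendsto (fun d' => t k • d') (𝓝 (d k)) (𝓝 (t k • d k)) :=
    (continuous_const_smul (t k)).tendsto _
  filter_upwards [hc.eventually hk] with d' hd'
  rw [smul_sub, add_add_sub_cancel, hd', hcone _ _ (ht k)]

/-- If `D` coincides near `p` with `p + T` for a closed cone `T`, then directional limiting
normals to `D` at `p` are limiting normals to `T`. -/
theorem dirNormalCone_eq_limNormalCone {D T : Set E} {p : E}
    (hev : ∀ᶠ w in 𝓝 (0 : E), p + w ∈ D ↔ w ∈ T) (hT : IsClosed T)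
    (hcone : ∀ (w : E) (t : ℝ), 0 < t → (t • w ∈ T ↔ w ∈ T)) (d : E) :
    dirNormalCone D p d = limNormalCone T d := by
  ext η
  constructor
  · rintro ⟨dk, t, ηk, hd, ht, ht0, hη, hN⟩
    obtain ⟨N, hN'⟩ := eventually_atTop.1 (eventually_regNormalCone_add_smul_eq hev hcone ht
      (by simpa using ht0.smul hd))
    have hmem : ∀ k, ηk (k + N) ∈ regNormalCone T (dk (k + N)) := fun k => by
      rw [← hN' _ (Nat.le_add_left _ _)]
      exact hN _
    have hd' := hd.comp (tendsto_add_atTop_nat N)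
    exact ⟨hT.mem_of_tendsto hd' (Eventually.of_forall fun k => (hmem k).1), _, _, hd',
      hη.comp (tendsto_add_atTop_nat N), hmem⟩
  · rintro ⟨-, dk, ηk, hd, hη, hN⟩
    -- T is invariant under scaling, so any null sequence of steps transports the normals from T to
    -- D.
    have ht : ∀ k : ℕ, (0 : ℝ) < 1 / ((k : ℝ) + 1) := fun k => by positivity
    have ht0 := tendsto_one_div_add_atTop_nhds_zero_nat (𝕜 := ℝ)
    obtain ⟨N, hN'⟩ := eventually_atTop.1 (eventually_regNormalCone_add_smul_eq hev hcone ht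
      (by simpa using ht0.smul hd))
    refine ⟨_, _, _, hd.comp (tendsto_add_atTop_nat N), fun k => ht (k + N),
      ht0.comp (tendsto_add_atTop_nat N), hη.comp (tendsto_add_atTop_nat N), fun k => ?_⟩
    have := hN' (k + N) (Nat.le_add_left _ _)
    simp only [Function.comp_apply]
    rw [this]
    exact hN _

/-- The ε-ball lies in the ε-box since |wᵢ| ≤ ‖w‖, so near p the box imposes nothing and D is p plus
its tangent cone. -/
theorem IsLocallyPolyhedral.exists_tangentSystem {m : ℕ} {D : Set (EuclideanSpace ℝ (Fin m))}
    {p : EuclideanSpace ℝ (Fin m)} (hD : IsLocallyPolyhedral D p) (hp : p ∈ D) :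
    ∃ 𝓣 : Finset (Finset (EuclideanSpace ℝ (Fin m) × ℝ)), tangentCone D p = polySet 𝓣 ∧
      (∀ᶠ w in 𝓝 0, p + w ∈ D ↔ w ∈ polySet 𝓣) ∧
      ∀ (w : EuclideanSpace ℝ (Fin m)) (t : ℝ), 0 < t → (t • w ∈ polySet 𝓣 ↔ w ∈ polySet 𝓣) := by
  obtain ⟨ε, hε, hpoly⟩ := hD
  obtain ⟨𝓗, h𝓗⟩ := hpoly.exists_eq_polySet
  have hev : ∀ᶠ w in 𝓝 0, p + w ∈ D ↔ w ∈ polySet (tangentSystem 𝓗 p) := by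
    filter_upwards [eventually_add_mem_polySet_iff 𝓗 p, Metric.ball_mem_nhds _ hε] with w hw hwε
    rw [← hw, ← h𝓗]
    refine ⟨fun h => ⟨h, fun i => ?_⟩, fun h => h.1⟩
    rw [mem_ball_zero_iff] at hwε
    simpa using (PiLp.norm_apply_le w i).trans hwε.le
  have hcone : ∀ (w : EuclideanSpace ℝ (Fin m)) (t : ℝ), 0 < t →
      (t • w ∈ polySet (tangentSystem 𝓗 p) ↔ w ∈ polySet (tangentSystem 𝓗 p)) :=
    fun _ _ => smul_mem_polySet_tangentSystem
  exact ⟨_, tangentCone_eq_of_eventually hp hev (isClosed_polySet _) hcone, hev, hcone⟩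

theorem exists_mem_tangentCone_limNormalCone_polySet_of_eventually [FiniteDimensional ℝ E]
    {X W : Type*} [NormedAddCommGroup X] [NormedSpace ℝ X] [FiniteDimensional ℝ X]
    [NormedAddCommGroup W] [NormedSpace ℝ W] {𝓗 : Finset (Finset (E × ℝ))}
    {e η : ℕ → E} (hη : ∀ᶠ k in atTop, η k ∈ regNormalCone (polySet 𝓗) (e k)) {y : E}
    (hy : Tendsto η atTop (𝓝 y)) {τ : ℕ → ℝ} (hτ : ∀ k, 0 < τ k) (A : E →L[ℝ] W) {b : W}
    (hA : Tendsto (fun k => A ((τ k)⁻¹ • (η k - y))) atTop (𝓝 b))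
    (B : X →L[ℝ] E) (s : ℕ → X) {w : E} (hB : Tendsto (fun k => e k - B (s k)) atTop (𝓝 w)) :
    ∃ s', ∃ z ∈ tangentCone (limNormalCone (polySet 𝓗) (w + B s')) y,
      A z = b ∧ y ∈ limNormalCone (polySet 𝓗) (w + B s') := by
  obtain ⟨N, hN⟩ := eventually_atTop.1 hη
  have hs := tendsto_add_atTop_nat N
  exact exists_mem_tangentCone_limNormalCone_polySet (fun k => hN (k + N) (Nat.le_add_left _ _))
    (hy.comp hs) (fun k => hτ (k + N)) A (hA.comp hs) B (fun k => s (k + N)) (hB.comp hs)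

end Conic

/-! ### Bounded or unbounded quotients along a graph. -/

section Graphical

variable {Y W : Type*} [NormedAddCommGroup Y] [InnerProductSpace ℝ Y] [FiniteDimensional ℝ Y]
  [NormedAddCommGroup W] [NormedSpace ℝ W]

/-- Either the difference quotients of a sequence in the graph of `S` have a cluster point in the
graphical derivative, or, after normalization, they produce a unit vector in the kernel of `A`
which belongs to the graphical derivative at `0` and to the graphical subderivative. -/
theorem exists_mem_graphicalDeriv_or {S : Y → Set Y} {p y d : Y} (hpy : y ∈ S p) {dk yk : ℕ → Y}
    {t τ : ℕ → ℝ} (hd : Tendsto dk atTop (𝓝 d)) (ht : ∀ k, 0 < t k) (ht0 : Tendsto t atTop (𝓝 0))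
    (hτ : ∀ k, 0 < τ k) (hτ0 : Tendsto τ atTop (𝓝 0))
    (htτ : Tendsto (fun k => t k / τ k) atTop (𝓝 1)) (hy : Tendsto yk atTop (𝓝 y))
    (hS : ∀ k, yk k ∈ S (p + t k • dk k)) (A : Y →L[ℝ] W) {b : W}
    (hA : Tendsto (fun k => A ((τ k)⁻¹ • (yk k - y))) atTop (𝓝 b)) :
    (∃ z ∈ graphicalDeriv S p y d, A z = b) ∨
    ∃ z, ‖z‖ = 1 ∧ A z = 0 ∧ z ∈ graphicalDeriv S p y 0 ∧
      (d ≠ 0 → z ∈ graphicalSubderiv S p y (‖d‖⁻¹ • d)) := by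
  set z : ℕ → Y := fun k => (τ k)⁻¹ • (yk k - y) with hzdef
  have hyz : ∀ k, y + τ k • z k = yk k := fun k => by
    rw [hzdef]
    simp only
    rw [smul_smul, mul_inv_cancel₀ (hτ k).ne', one_smul, add_sub_cancel]
  have htd : Tendsto (fun k => (t k / τ k) • dk k) atTop (𝓝 d) := by
    simpa using htτ.smul hd
  have hpd : ∀ k, p + τ k • (t k / τ k) • dk k = p + t k • dk k := fun k => by
    rw [smul_smul, mul_div_cancel₀ _ (hτ k).ne']
  by_cases hbd : ∃ R, ∃ᶠ k in atTop, ‖z k‖ ≤ R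
  · left
    obtain ⟨R, hR⟩ := hbd
    obtain ⟨z', -, φ, hφ, hz⟩ := tendsto_subseq_of_frequently_bounded
      (Metric.isBounded_closedBall (x := (0 : Y)) (r := R))
      (hR.mono fun k hk => by simpa using hk)
    have hφ' := hφ.tendsto_atTop
    refine ⟨z', ⟨hpy, fun k => WithLp.toLp 2 ((t (φ k) / τ (φ k)) • dk (φ k), z (φ k)),
      fun k => τ (φ k), ?_, fun k => hτ _, hτ0.comp hφ', fun k => ?_⟩, ?_⟩
    · exact ((WithLp.prod_continuous_toLp 2 Y Y).tendsto _).comp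
        ((htd.comp hφ').prodMk_nhds hz)
    · change y + τ (φ k) • z (φ k) ∈ S (p + τ (φ k) • (t (φ k) / τ (φ k)) • dk (φ k))
      rw [hyz, hpd]
      exact hS _
    · exact tendsto_nhds_unique ((A.continuous.tendsto z').comp hz) (hA.comp hφ')
  · right
    push Not at hbd
    have hinf : Tendsto (fun k => ‖z k‖) atTop atTop :=
      tendsto_atTop.2 fun R => (hbd R).mono fun k hk => hk.le
    obtain ⟨ψ, hψ, hψ0⟩ := extraction_of_eventually_atTop (hinf.eventually_gt_atTop 0)
    obtain ⟨z', -, φ', hφ', hz'⟩ := (isCompact_closedBall (0 : Y) 1).tendsto_subseq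
      (x := fun k => ‖z (ψ k)‖⁻¹ • z (ψ k)) (fun k => by
        simp only [mem_closedBall_zero_iff, norm_smul, norm_inv, norm_norm]
        exact inv_mul_le_one)
    obtain ⟨φ, hφ, hm0, hz⟩ : ∃ φ : ℕ → ℕ, Tendsto φ atTop atTop ∧ (∀ k, 0 < ‖z (φ k)‖) ∧
        Tendsto (fun k => ‖z (φ k)‖⁻¹ • z (φ k)) atTop (𝓝 z') :=
      ⟨fun k => ψ (φ' k), hψ.tendsto_atTop.comp hφ'.tendsto_atTop, fun k => hψ0 _, hz'⟩
    have hminf := hinf.comp hφ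
    have hinv : Tendsto (fun k => ‖z (φ k)‖⁻¹) atTop (𝓝 0) := tendsto_inv_atTop_zero.comp hminf
    -- The step after normalization is τ‖z‖ = ‖yk - y‖, which tends to 0. Relative to it the
    -- displacement in the domain is ‖z‖⁻¹(t/τ) dk → 0, whence the derivative at 0.
    have hσ : ∀ k, 0 < τ (φ k) * ‖z (φ k)‖ := fun k => mul_pos (hτ _) (hm0 k)
    have hyσ : ∀ k, y + (τ (φ k) * ‖z (φ k)‖) • ‖z (φ k)‖⁻¹ • z (φ k) = yk (φ k) := fun k => by
      rw [smul_smul, mul_assoc, mul_inv_cancel₀ (hm0 k).ne', mul_one, hyz]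
    have hσ0 : Tendsto (fun k => τ (φ k) * ‖z (φ k)‖) atTop (𝓝 0) := by
      have h1 : Tendsto (fun k => ‖yk (φ k) - y‖) atTop (𝓝 0) := by
        simpa using ((hy.comp hφ).sub_const y).norm
      refine h1.congr fun k => ?_
      rw [← hyz, add_sub_cancel_left, norm_smul, Real.norm_of_nonneg (hτ _).le]
    have hz1 : ‖z'‖ = 1 := by
      refine tendsto_nhds_unique hz.norm (tendsto_const_nhds.congr fun k => ?_)
      simp [norm_smul, inv_mul_cancel₀ (hm0 k).ne']
    refine ⟨z', hz1, ?_, ?_, fun hd0 => ⟨hz1, ?_⟩⟩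
    · refine tendsto_nhds_unique ((A.continuous.tendsto z').comp hz) ?_
      have h0 := hinv.smul (hA.comp hφ)
      rw [zero_smul] at h0
      exact h0.congr fun k => (map_smul A _ _).symm
    · refine ⟨hpy, fun k => WithLp.toLp 2 (‖z (φ k)‖⁻¹ • (t (φ k) / τ (φ k)) • dk (φ k),
        ‖z (φ k)‖⁻¹ • z (φ k)), fun k => τ (φ k) * ‖z (φ k)‖, ?_, hσ, hσ0, fun k => ?_⟩
      · refine ((WithLp.prod_continuous_toLp 2 Y Y).tendsto _).comp (Tendsto.prodMk_nhds ?_ hz)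
        simpa using hinv.smul (htd.comp hφ)
      · change y + (τ (φ k) * ‖z (φ k)‖) • ‖z (φ k)‖⁻¹ • z (φ k) ∈
          S (p + (τ (φ k) * ‖z (φ k)‖) • ‖z (φ k)‖⁻¹ • (t (φ k) / τ (φ k)) • dk (φ k))
        rw [hyσ, smul_smul _ ‖z (φ k)‖⁻¹, mul_assoc, mul_inv_cancel₀ (hm0 k).ne', mul_one, hpd]
        exact hS _
    -- For the subderivative the same points are read with step t‖d‖ in the domain and τ‖z‖ in the
    -- range; the ratio diverges because t/τ → 1 and ‖z‖ → ∞.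
    · have hdn : 0 < ‖d‖ := norm_pos_iff.2 hd0
      refine ⟨fun k => ‖d‖⁻¹ • dk (φ k), fun k => ‖z (φ k)‖⁻¹ • z (φ k),
        fun k => t (φ k) * ‖d‖, fun k => τ (φ k) * ‖z (φ k)‖, (hd.comp hφ).const_smul _, hz,
        fun k => mul_pos (ht _) hdn, ?_, hσ, hσ0, ?_, fun k => ?_⟩
      · simpa using (ht0.comp hφ).mul_const ‖d‖
      · have h1 : Tendsto (fun k => (t (φ k) / τ (φ k))⁻¹ * ‖d‖⁻¹) atTop (𝓝 ‖d‖⁻¹) := by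
          simpa using ((htτ.comp hφ).inv₀ one_ne_zero).mul_const ‖d‖⁻¹
        refine (hminf.atTop_mul_pos (inv_pos.2 hdn) h1).congr fun k => ?_
        have := ht (φ k)
        have := hτ (φ k)
        simp only [Function.comp_apply]
        field_simp
      · change y + (τ (φ k) * ‖z (φ k)‖) • ‖z (φ k)‖⁻¹ • z (φ k) ∈
          S (p + (t (φ k) * ‖d‖) • ‖d‖⁻¹ • dk (φ k))
        rw [hyσ, smul_smul _ ‖d‖⁻¹, mul_assoc, mul_inv_cancel₀ hdn.ne', mul_one]
        exact hS _

end Graphical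

/-! ### Unfolding the pseudo-coderivatives of order 2. -/

section Coderivatives

variable {X Y : Type*} [NormedAddCommGroup X] [InnerProductSpace ℝ X] [FiniteDimensional ℝ X]
  [NormedAddCommGroup Y] [InnerProductSpace ℝ Y] [FiniteDimensional ℝ Y]

/-- Regular normals form a cone, so multiplying by τ removes the factor τ⁻¹ from the normal to D; it
survives only in front of ∇g(x)* y. -/
theorem scaled_normal_relation {g : X → Y} {D : Set Y} {x a : X} {w y : Y} {τ : ℝ}
    (hg : DifferentiableAt ℝ g x) (hτ : 0 < τ)
    (h : WithLp.toLp 2 (a, -((τ ^ ((2 : ℝ) - 1))⁻¹ • y)) ∈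
      regNormalCone (gph (constraintMap g D)) (WithLp.toLp 2 (x, w))) :
    a = τ⁻¹ • adjDeriv g x y ∧ y ∈ regNormalCone D (g x - w) := by
  have h2 : τ ^ ((2 : ℝ) - 1) = τ := by norm_num
  rw [h2] at h
  obtain ⟨h3, h4⟩ := regNormalCone_gph_constraintMap hg h
  rw [map_neg, neg_neg, map_smul] at h3
  refine ⟨h3, ?_⟩
  have h5 := smul_mem_regNormalCone hτ h4
  rwa [neg_neg, smul_smul, mul_inv_cancel₀ hτ.ne', one_smul] at h5

theorem exists_seq_of_mem_gfrererPseudoCoderiv {g : X → Y} {D : Set Y} (hg : Differentiable ℝ g)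
    {x u xs : X} {v ys : Y} (hu1 : ‖u‖ = 1)
    (h : xs ∈ gfrererPseudoCoderiv 2 (constraintMap g D) x 0 u v ys) :
    ∃ (uk xsk : ℕ → X) (vk ysk : ℕ → Y) (t : ℕ → ℝ),
      Tendsto uk atTop (𝓝 u) ∧ Tendsto vk atTop (𝓝 v) ∧
      (∀ k, 0 < t k) ∧ Tendsto t atTop (𝓝 0) ∧
      Tendsto xsk atTop (𝓝 xs) ∧ Tendsto ysk atTop (𝓝 ys) ∧ (∀ k, 0 < ‖uk k‖) ∧
      (∀ k, xsk k = (t k * ‖uk k‖)⁻¹ • adjDeriv g (x + t k • uk k) (ysk k)) ∧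
      ∀ k, ysk k ∈ regNormalCone D (g (x + t k • uk k) - t k • vk k) := by
  obtain ⟨uk, xsk, vk, ysk, t, hu, hv, ht, ht0, hxs, hys, hN⟩ := h
  -- Finitely many `uk k` may vanish, which would make the scaling degenerate; those terms are
  -- dropped.
  obtain ⟨N, hN0⟩ := eventually_atTop.1
    (hu.norm.eventually (lt_mem_nhds (show (0 : ℝ) < ‖u‖ by rw [hu1]; exact one_pos)))
  have hs := tendsto_add_atTop_nat N
  have hu0 : ∀ k, 0 < ‖uk (k + N)‖ := fun k => hN0 _ (Nat.le_add_left _ _)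
  have hrel := fun k => scaled_normal_relation (hg _) (mul_pos (ht (k + N)) (hu0 k)) (hN (k + N))
  refine ⟨_, _, _, _, _, hu.comp hs, hv.comp hs, fun k => ht (k + N), ht0.comp hs, hxs.comp hs,
    hys.comp hs, hu0, fun k => (hrel k).1, fun k => ?_⟩
  have := (hrel k).2
  rwa [zero_add] at this

theorem exists_seq_of_mem_pseudoCoderiv {g : X → Y} {D : Set Y} (hg : Differentiable ℝ g)
    {x u xs : X} {v ys : Y} (hu1 : ‖u‖ = 1)
    (h : xs ∈ pseudoCoderiv 2 (constraintMap g D) x 0 u v ys) :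
    ∃ (uk xsk : ℕ → X) (vk ysk : ℕ → Y) (t : ℕ → ℝ),
      Tendsto uk atTop (𝓝 u) ∧ Tendsto vk atTop (𝓝 v) ∧
      (∀ k, 0 < t k) ∧ Tendsto t atTop (𝓝 0) ∧
      Tendsto xsk atTop (𝓝 xs) ∧ Tendsto ysk atTop (𝓝 ys) ∧ (∀ k, 0 < ‖uk k‖) ∧
      (∀ k, xsk k = (t k * ‖uk k‖)⁻¹ • adjDeriv g (x + t k • uk k) (ysk k)) ∧
      ∀ k, ysk k ∈ regNormalCone D (g (x + t k • uk k) - (t k * ‖uk k‖) ^ 2 • vk k) := by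
  obtain ⟨uk, xsk, vk, ysk, t, hu, hv, ht, ht0, hxs, hys, hN⟩ := h
  obtain ⟨N, hN0⟩ := eventually_atTop.1
    (hu.norm.eventually (lt_mem_nhds (show (0 : ℝ) < ‖u‖ by rw [hu1]; exact one_pos)))
  have hs := tendsto_add_atTop_nat N
  have hu0 : ∀ k, 0 < ‖uk (k + N)‖ := fun k => hN0 _ (Nat.le_add_left _ _)
  have hrel := fun k => scaled_normal_relation (hg _) (mul_pos (ht (k + N)) (hu0 k)) (hN (k + N))
  refine ⟨_, _, _, _, _, hu.comp hs, hv.comp hs, fun k => ht (k + N), ht0.comp hs, hxs.comp hs,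
    hys.comp hs, hu0, fun k => (hrel k).1, fun k => ?_⟩
  have := (hrel k).2
  rwa [zero_add, Real.rpow_two] at this

end Coderivatives

/-! ### The multiplier relations. -/

section MainParts

theorem mem_of_zero_mem_constraintMap {X Y : Type*} [NormedAddCommGroup Y] {g : X → Y} {D : Set Y} {x : X}
    (h : (0 : Y) ∈ constraintMap g D x) : g x ∈ D := by
  obtain ⟨d, hd, h0⟩ := h
  rwa [← sub_eq_zero.1 h0.symm] at hd

variable {X Y : Type*} [NormedAddCommGroup X] [InnerProductSpace ℝ X] [FiniteDimensional ℝ X]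
  [NormedAddCommGroup Y] [InnerProductSpace ℝ Y] [FiniteDimensional ℝ Y]

/-- Sequential form of Gfrerer's pseudo-coderivative of order 2 of a constraint mapping. -/
theorem exists_normal_seq_of_mem_gfrererPseudoCoderiv {g : X → Y} {D : Set Y}
    (hg : ContDiff ℝ 2 g) {x u xs : X} {v ys : Y} (hu1 : ‖u‖ = 1)
    (h : xs ∈ gfrererPseudoCoderiv 2 (constraintMap g D) x 0 u v ys) :
    ∃ (dk ysk : ℕ → Y) (t τ : ℕ → ℝ), Tendsto dk atTop (𝓝 (fderiv ℝ g x u - v)) ∧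
      (∀ k, 0 < t k) ∧ Tendsto t atTop (𝓝 0) ∧ (∀ k, 0 < τ k) ∧ Tendsto τ atTop (𝓝 0) ∧
      Tendsto (fun k => t k / τ k) atTop (𝓝 1) ∧ Tendsto ysk atTop (𝓝 ys) ∧
      (∀ k, ysk k ∈ regNormalCone D (g x + t k • dk k)) ∧ adjDeriv g x ys = 0 ∧
      Tendsto (fun k => adjDeriv g x ((τ k)⁻¹ • (ysk k - ys))) atTop
        (𝓝 (xs - scalarHess ys g x u)) := by
  have hd : Differentiable ℝ g := hg.differentiable (by norm_num)
  obtain ⟨uk, xsk, vk, ysk, t, hu, hv, ht, ht0, hxs, hys, hu0, hrel, hN⟩ :=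
    exists_seq_of_mem_gfrererPseudoCoderiv hd hu1 h
  obtain ⟨hker, hA⟩ := tendsto_adjDeriv_quotient hg hu1 hu hu0 ht ht0 hxs hys hrel
  have hun : Tendsto (fun k => ‖uk k‖) atTop (𝓝 1) := by simpa [hu1] using hu.norm
  -- The direction is chosen so that g(x) + t d_k = g(x + t u_k) - t v_k exactly.
  refine ⟨fun k => (t k)⁻¹ • (g (x + t k • uk k) - g x) - vk k, ysk, t, fun k => t k * ‖uk k‖,
    (tendsto_inv_smul_sub (hd x).hasFDerivAt hu ht ht0).sub hv, ht, ht0,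
    fun k => mul_pos (ht k) (hu0 k), by simpa using ht0.mul hun, ?_, hys, fun k => ?_, hker, hA⟩
  · have h1 := hun.inv₀ one_ne_zero
    rw [inv_one] at h1
    refine h1.congr fun k => ?_
    have := ht k
    have := hu0 k
    field_simp
  · have : g x + t k • ((t k)⁻¹ • (g (x + t k • uk k) - g x) - vk k) =
        g (x + t k • uk k) - t k • vk k := by
      rw [smul_sub, smul_smul, mul_inv_cancel₀ (ht k).ne', one_smul]
      abel
    rw [this]
    exact hN k

/-- Sequential form of the pseudo-coderivative of order 2 of a constraint mapping. -/
theorem exists_normal_seq_of_mem_pseudoCoderiv {g : X → Y} {D : Set Y}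
    (hg : ContDiff ℝ 2 g) {x u xs : X} {v ys : Y} (hu1 : ‖u‖ = 1)
    (h : xs ∈ pseudoCoderiv 2 (constraintMap g D) x 0 u v ys) :
    ∃ (ek ysk : ℕ → Y) (sk : ℕ → X) (t τ : ℕ → ℝ),
      (∀ k, 0 < t k) ∧ Tendsto t atTop (𝓝 0) ∧ (∀ k, 0 < τ k) ∧
      Tendsto (fun k => t k • ek k) atTop (𝓝 0) ∧
      Tendsto (fun k => ek k - fderiv ℝ g x (sk k)) atTop
        (𝓝 ((1 / 2 : ℝ) • fderiv ℝ (fderiv ℝ g) x u u - v)) ∧ Tendsto ysk atTop (𝓝 ys) ∧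
      (∀ k, ysk k ∈ regNormalCone D (g x + t k • (fderiv ℝ g x u + t k • ek k))) ∧
      adjDeriv g x ys = 0 ∧
      Tendsto (fun k => adjDeriv g x ((τ k)⁻¹ • (ysk k - ys))) atTop
        (𝓝 (xs - scalarHess ys g x u)) := by
  have hd : Differentiable ℝ g := hg.differentiable (by norm_num)
  obtain ⟨uk, xsk, vk, ysk, t, hu, hv, ht, ht0, hxs, hys, hu0, hrel, hN⟩ :=
    exists_seq_of_mem_pseudoCoderiv hd hu1 h
  obtain ⟨hker, hA⟩ := tendsto_adjDeriv_quotient hg hu1 hu hu0 ht ht0 hxs hys hrel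
  have hun : Tendsto (fun k => ‖uk k‖) atTop (𝓝 1) := by simpa [hu1] using hu.norm
  have hwv := (tendsto_second_order_quotient hg (x := x) hu ht ht0).sub ((hun.pow 2).smul hv)
  rw [one_pow, one_smul] at hwv
  let r : ℕ → Y := fun k => (t k ^ 2)⁻¹ • (g (x + t k • uk k) - g x - t k • fderiv ℝ g x (uk k)) -
    ‖uk k‖ ^ 2 • vk k
  have hr : ∀ k, (t k * t k) • r k =
      g (x + t k • uk k) - g x - t k • fderiv ℝ g x (uk k) - (t k * ‖uk k‖) ^ 2 • vk k := by
    intro k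
    simp only [r]
    rw [← pow_two, smul_sub, smul_smul, mul_inv_cancel₀ (pow_pos (ht k) 2).ne', one_smul,
      smul_smul, mul_pow]
  -- Here s_k = (u_k - u)/t_k may be unbounded: e_k converges only modulo ∇g(x)s_k, and t_k e_k → 0
  -- is all that is known of its size.
  refine ⟨fun k => r k + fderiv ℝ g x ((t k)⁻¹ • (uk k - u)), ysk,
    fun k => (t k)⁻¹ • (uk k - u), t, fun k => t k * ‖uk k‖, ht, ht0,
    fun k => mul_pos (ht k) (hu0 k), ?_, by simpa only [add_sub_cancel_right] using hwv, hys,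
    fun k => ?_, hker, hA⟩
  · have h1 : Tendsto (fun k => t k • r k + fderiv ℝ g x (uk k - u)) atTop (𝓝 0) := by
      have h2 := ((fderiv ℝ g x).continuous.tendsto _).comp (hu.sub_const u)
      simpa using (ht0.smul hwv).add h2
    refine h1.congr fun k => ?_
    beta_reduce
    rw [map_smul, smul_add, smul_smul (t k), mul_inv_cancel₀ (ht k).ne', one_smul]
  · have : g x + t k • (fderiv ℝ g x u + t k • (r k + fderiv ℝ g x ((t k)⁻¹ • (uk k - u)))) =
        g (x + t k • uk k) - (t k * ‖uk k‖) ^ 2 • vk k := by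
      rw [map_smul, smul_add (t k) (r k), smul_smul (t k) (t k)⁻¹, mul_inv_cancel₀ (ht k).ne',
        one_smul, map_sub, smul_add, smul_add, smul_smul, hr, smul_sub]
      abel
    rw [this]
    exact hN k

/-- The multiplier relations for an arbitrary closed set `D`. -/
theorem exists_inner_eq_zero_multiplier {g : X → Y} {D : Set Y} (hg : ContDiff ℝ 2 g)
    {x u xs : X} {v ys : Y} (hu1 : ‖u‖ = 1)
    (h : xs ∈ gfrererPseudoCoderiv 2 (constraintMap g D) x 0 u v ys) :
    ∃ zs : Y, inner ℝ ys zs = 0 ∧ xs = scalarHess ys g x u + adjDeriv g x zs ∧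
      ys ∈ dirNormalCone D (g x) (fderiv ℝ g x u - v) ∩ kerAdjDeriv g x := by
  obtain ⟨dk, ysk, t, τ, hd, ht, ht0, hτ, hτ0, htτ, hys, hN, hker, hA⟩ :=
    exists_normal_seq_of_mem_gfrererPseudoCoderiv hg hu1 h
  have hmem : ys ∈ dirNormalCone D (g x) (fderiv ℝ g x u - v) ∩ kerAdjDeriv g x :=
    ⟨⟨dk, t, ysk, hd, ht, ht0, hys, hN⟩, hker⟩
  have hcl : IsClosed ((adjDeriv g x : Y →ₗ[ℝ] X).range : Set X) :=
    Submodule.closed_of_finiteDimensional _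
  obtain ⟨z, hz⟩ := hcl.mem_of_tendsto hA (Eventually.of_forall fun k => ⟨_, rfl⟩)
  have hz' : adjDeriv g x z = xs - scalarHess ys g x u := hz
  -- Removing the component along y* leaves ∇g(x)* z unchanged. For y* = 0 the quotient is 0/0 = 0,
  -- and orthogonality is trivial.
  refine ⟨z - ((inner ℝ ys z : ℝ) / ‖ys‖ ^ 2) • ys, ?_, ?_, hmem⟩
  · rw [inner_sub_right, real_inner_smul_right, real_inner_self_eq_norm_sq]
    rcases eq_or_ne ys 0 with rfl | h0
    · simp
    · rw [div_mul_cancel₀ _ (by simpa using h0), sub_self]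
  · rw [map_sub, map_smul, hker, smul_zero, sub_zero, hz', add_sub_cancel]

theorem exists_graphicalDeriv_multiplier {g : X → Y} {D : Set Y} (hg : ContDiff ℝ 2 g)
    {x u xs : X} {v ys : Y} (hx : g x ∈ D) (hu1 : ‖u‖ = 1)
    (h : xs ∈ gfrererPseudoCoderiv 2 (constraintMap g D) x 0 u v ys)
    (hreg : graphicalDeriv (limNormalCone D) (g x) ys 0 ∩ kerAdjDeriv g x = {0} ∨
      (fderiv ℝ g x u ≠ v ∧ graphicalSubderiv (limNormalCone D) (g x) ys
        (‖fderiv ℝ g x u - v‖⁻¹ • (fderiv ℝ g x u - v)) ∩ kerAdjDeriv g x = ∅)) :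
    ∃ zs ∈ graphicalDeriv (limNormalCone D) (g x) ys (fderiv ℝ g x u - v),
      xs = scalarHess ys g x u + adjDeriv g x zs := by
  obtain ⟨dk, ysk, t, τ, hd, ht, ht0, hτ, hτ0, htτ, hys, hN, hker, hA⟩ :=
    exists_normal_seq_of_mem_gfrererPseudoCoderiv hg hu1 h
  have hlim : ys ∈ limNormalCone D (g x) := by
    refine ⟨hx, _, ysk, ?_, hys, hN⟩
    simpa using (tendsto_const_nhds (x := g x)).add (ht0.smul hd)
  rcases exists_mem_graphicalDeriv_or (S := limNormalCone D) hlim hd ht ht0 hτ hτ0 htτ hys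
    (fun k => regNormalCone_subset_limNormalCone _ _ (hN k)) (adjDeriv g x) hA with
    ⟨z, hz, hAz⟩ | ⟨z, hz1, hAz, hz0, hzsub⟩
  · exact ⟨z, hz, by rw [hAz, add_sub_cancel]⟩
  · exfalso
    rcases hreg with hreg | ⟨hne, hreg⟩
    · have : z ∈ ({0} : Set Y) := hreg ▸ ⟨hz0, hAz⟩
      rw [Set.mem_singleton_iff.1 this, norm_zero] at hz1
      exact zero_ne_one hz1
    · have : z ∈ (∅ : Set Y) := hreg ▸ ⟨hzsub (sub_ne_zero.2 hne), hAz⟩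
      exact this

variable {m : ℕ} {g : X → EuclideanSpace ℝ (Fin m)} {D : Set (EuclideanSpace ℝ (Fin m))}

theorem IsLocallyPolyhedral.dirNormalCone_eq {p : EuclideanSpace ℝ (Fin m)}
    (hD : IsLocallyPolyhedral D p) (hp : p ∈ D) (d : EuclideanSpace ℝ (Fin m)) :
    dirNormalCone D p d = limNormalCone (tangentCone D p) d := by
  obtain ⟨𝓣, hT, hev, hcone⟩ := hD.exists_tangentSystem hp
  rw [hT]
  exact dirNormalCone_eq_limNormalCone hev (isClosed_polySet 𝓣) hcone d

theorem exists_polyhedral_multiplier (hg : ContDiff ℝ 2 g) {x u xs : X}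
    {v ys : EuclideanSpace ℝ (Fin m)} (hx : g x ∈ D) (hu1 : ‖u‖ = 1)
    (hD : IsLocallyPolyhedral D (g x))
    (h : xs ∈ gfrererPseudoCoderiv 2 (constraintMap g D) x 0 u v ys) :
    ∃ zs ∈ tangentCone (limNormalCone (tangentCone D (g x)) (fderiv ℝ g x u - v)) ys,
      xs = scalarHess ys g x u + adjDeriv g x zs := by
  obtain ⟨dk, ysk, t, τ, hd, ht, ht0, hτ, hτ0, htτ, hys, hN, hker, hA⟩ :=
    exists_normal_seq_of_mem_gfrererPseudoCoderiv hg hu1 h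
  obtain ⟨𝓣, hT, hev, hcone⟩ := hD.exists_tangentSystem hx
  have hNT : ∀ᶠ k in atTop, ysk k ∈ regNormalCone (polySet 𝓣) (dk k) := by
    filter_upwards [eventually_regNormalCone_add_smul_eq hev hcone ht
      (by simpa using ht0.smul hd)] with k hk
    rw [← hk]
    exact hN k
  -- The directions d_k converge by themselves, so the shift map is taken to be zero.
  obtain ⟨s, z, hz, hAz, -⟩ := exists_mem_tangentCone_limNormalCone_polySet_of_eventually hNT hys
    hτ (adjDeriv g x) hA (0 : X →L[ℝ] EuclideanSpace ℝ (Fin m)) (fun _ => 0)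
    (w := fderiv ℝ g x u - v) (by simpa using hd)
  rw [zero_apply, add_zero] at hz
  exact ⟨z, hT ▸ hz, by rw [hAz, add_sub_cancel]⟩

theorem exists_second_order_polyhedral_multiplier (hg : ContDiff ℝ 2 g) {x u xs : X}
    {v ys : EuclideanSpace ℝ (Fin m)} (hx : g x ∈ D) (hu1 : ‖u‖ = 1)
    (hD : IsLocallyPolyhedral D (g x))
    (h : xs ∈ pseudoCoderiv 2 (constraintMap g D) x 0 u v ys) :
    ∃ s : X, ∃ zs ∈ tangentCone (limNormalCone (bigT g D x u) (wVec g x s u v)) ys,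
      xs = scalarHess ys g x u + adjDeriv g x zs ∧
      ys ∈ limNormalCone (bigT g D x u) (wVec g x s u v) ∩ kerAdjDeriv g x := by
  obtain ⟨ek, ysk, sk, t, τ, ht, ht0, hτ, hte, hes, hys, hN, hker, hA⟩ :=
    exists_normal_seq_of_mem_pseudoCoderiv hg hu1 h
  obtain ⟨𝓣, hT, hev, hcone⟩ := hD.exists_tangentSystem hx
  have hd : Tendsto (fun k => fderiv ℝ g x u + t k • ek k) atTop (𝓝 (fderiv ℝ g x u)) := by
    simpa using (tendsto_const_nhds (x := fderiv ℝ g x u)).add hte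
  have hNT : ∀ᶠ k in atTop,
      ysk k ∈ regNormalCone (polySet 𝓣) (fderiv ℝ g x u + t k • ek k) := by
    filter_upwards [eventually_regNormalCone_add_smul_eq hev hcone ht
      (by simpa only [zero_smul] using ht0.smul hd)] with k hk
    rw [← hk]
    exact hN k
  -- Needed because the tangent cone in `bigT` is empty off the base set.
  have hu𝓣 : fderiv ℝ g x u ∈ polySet 𝓣 :=
    (isClosed_polySet 𝓣).mem_of_tendsto hd (hNT.mono fun k hk => hk.1)
  have hbig : bigT g D x u = polySet (tangentSystem 𝓣 (fderiv ℝ g x u)) := by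
    rw [bigT, hT, tangentCone_polySet hu𝓣]
  -- A second localization, now of the tangent cone at ∇g(x)u, strips the remaining factor t and
  -- leaves normals at e_k itself.
  have hNT' : ∀ᶠ k in atTop,
      ysk k ∈ regNormalCone (polySet (tangentSystem 𝓣 (fderiv ℝ g x u))) (ek k) := by
    filter_upwards [hNT, eventually_regNormalCone_add_smul_eq
      (eventually_add_mem_polySet_iff 𝓣 (fderiv ℝ g x u))
      (fun _ _ => smul_mem_polySet_tangentSystem) ht hte] with k hk1 hk2
    rw [← hk2]
    exact hk1
  obtain ⟨s, z, hz, hAz, hy⟩ := exists_mem_tangentCone_limNormalCone_polySet_of_eventually hNT'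
    hys hτ (adjDeriv g x) hA (fderiv ℝ g x) sk hes
  have hw : wVec g x s u v =
      (1 / 2 : ℝ) • fderiv ℝ (fderiv ℝ g) x u u - v + fderiv ℝ g x s := by
    rw [wVec, secondDeriv_eq hg]
    abel
  rw [hbig]
  refine ⟨s, z, ?_, by rw [hAz, add_sub_cancel], ?_, hker⟩
  · rwa [hw]
  · rwa [hw]

end MainParts

end VarAnalysis

/-! ### Assembly of the four statements. -/

theorem theorem3p2 {X : Type*} [NormedAddCommGroup X] [InnerProductSpace ℝ X]
    [FiniteDimensional ℝ X] :
    -- arbitrary Euclidean image space: parts (i) and (ii)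
    (∀ (Y : Type*) [NormedAddCommGroup Y] [InnerProductSpace ℝ Y] [FiniteDimensional ℝ Y]
      (g : X → Y) (D : Set Y), ContDiff ℝ 2 g → IsClosed D →
      ∀ (xbar u : X), (0 : Y) ∈ constraintMap g D xbar → ‖u‖ = 1 →
      ∀ (v ys : Y) (xs : X),
        xs ∈ gfrererPseudoCoderiv 2 (constraintMap g D) xbar 0 u v ys →
        -- (i)
        (∃ zs : Y, inner ℝ ys zs = 0 ∧
          xs = scalarHess ys g xbar u + adjDeriv g xbar zs ∧
          ys ∈ dirNormalCone D (g xbar) (fderiv ℝ g xbar u - v) ∩ kerAdjDeriv g xbar) ∧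
        -- (ii)
        ((graphicalDeriv (limNormalCone D) (g xbar) ys 0 ∩ kerAdjDeriv g xbar = {0} ∨
          (fderiv ℝ g xbar u ≠ v ∧
            graphicalSubderiv (limNormalCone D) (g xbar) ys
              (‖fderiv ℝ g xbar u - v‖⁻¹ • (fderiv ℝ g xbar u - v)) ∩ kerAdjDeriv g xbar = ∅)) →
          ∃ zs ∈ graphicalDeriv (limNormalCone D) (g xbar) ys (fderiv ℝ g xbar u - v),
            xs = scalarHess ys g xbar u + adjDeriv g xbar zs ∧
            ys ∈ dirNormalCone D (g xbar) (fderiv ℝ g xbar u - v) ∩ kerAdjDeriv g xbar)) ∧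
    -- image space `ℝᵐ` and locally polyhedral `D`: parts (iii) and (iv)
    (∀ (m : ℕ) (g : X → EuclideanSpace ℝ (Fin m)) (D : Set (EuclideanSpace ℝ (Fin m))),
      ContDiff ℝ 2 g → IsClosed D →
      ∀ (xbar u : X), (0 : EuclideanSpace ℝ (Fin m)) ∈ constraintMap g D xbar → ‖u‖ = 1 →
      IsLocallyPolyhedral D (g xbar) →
      ∀ (v ys : EuclideanSpace ℝ (Fin m)) (xs : X),
        -- (iii)
        (xs ∈ gfrererPseudoCoderiv 2 (constraintMap g D) xbar 0 u v ys →
          dirNormalCone D (g xbar) (fderiv ℝ g xbar u - v) =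
            limNormalCone (tangentCone D (g xbar)) (fderiv ℝ g xbar u - v) ∧
          ∃ zs ∈ tangentCone
              (limNormalCone (tangentCone D (g xbar)) (fderiv ℝ g xbar u - v)) ys,
            xs = scalarHess ys g xbar u + adjDeriv g xbar zs ∧
            ys ∈ dirNormalCone D (g xbar) (fderiv ℝ g xbar u - v) ∩ kerAdjDeriv g xbar) ∧
        -- (iv)
        (xs ∈ pseudoCoderiv 2 (constraintMap g D) xbar 0 u v ys →
          ∃ s : X, ∃ zs ∈ tangentCone (limNormalCone (bigT g D xbar u) (wVec g xbar s u v)) ys,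
            xs = scalarHess ys g xbar u + adjDeriv g xbar zs ∧
            ys ∈ limNormalCone (bigT g D xbar u) (wVec g xbar s u v) ∩ kerAdjDeriv g xbar)) := by
  refine ⟨fun Y _ _ _ g D hg hD xbar u h0 hu v ys xs h => ?_,
    fun m g D hg hD xbar u h0 hu hpoly v ys xs => ⟨fun h => ?_, fun h => ?_⟩⟩
  · have hi := exists_inner_eq_zero_multiplier hg hu h
    refine ⟨hi, fun hreg => ?_⟩
    obtain ⟨z, hz, hxs⟩ := exists_graphicalDeriv_multiplier hg
      (mem_of_zero_mem_constraintMap h0) hu h hreg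
    obtain ⟨-, -, -, hmem⟩ := hi
    exact ⟨z, hz, hxs, hmem⟩
  · obtain ⟨-, -, -, hmem⟩ := exists_inner_eq_zero_multiplier hg hu h
    have hx := mem_of_zero_mem_constraintMap h0
    obtain ⟨z, hz, hxs⟩ := exists_polyhedral_multiplier hg hx hu hpoly h
    exact ⟨hpoly.dirNormalCone_eq hx _, z, hz, hxs, hmem⟩
  · exact exists_second_order_polyhedral_multiplier hg (mem_of_zero_mem_constraintMap h0) hu
      hpoly h
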